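/- Consider a norm $N$ on $\mathbb{R}^2$, and write $[a,b]$ for the determinant of the matrix with columns $a,b\in\mathbb{R}^2$. Let $u:[0,2T]\to\mathbb{R}^2$, $T>0$, with $u(0)=u(2T)$ and $u$ injective on $[0,2T)$, be a parameterization of the unit circle $\{N=1\}$ that is smooth by parts in the following sense: there are $n\ge 1$ and $0=t_0<t_1<\dots<t_{2n}=2T$ such that, on each closed interval $[t_i,t_{i+1}]$, $0\le i<2n$, $u$ is smooth (with one-sided derivatives at the endpoints) with $u'\ne 0$; each arc $u_i=u([t_i,t_{i+1}])$ is either strictly convex, with $[u',u'']\neq 0$ on $[t_i,t_{i+1}]$, or a straight segment; $u_{i+n}=-u_i$ for $0\le i<n$; and two (cyclically) consecutive segments never lie on one line. Call a closed curve $\gamma:[0,2T]\to\mathbb{R}^2$, $\gamma(0)=\gamma(2T)$, admissible if it is smooth on each $[t_i,t_{i+1}]$ and there $\gamma'(t)=r(t)u'(t)$ for some scalar function $r$ (of arbitrary sign, so that $\gamma$ need not be convex), where $r$ is constant on every interval on which $u$ is a straight segment. Define the signed dual length and the signed area by $$L_*(\gamma)=\int_0^{2T} r(t)\,[u(t),u'(t)]\,dt,\qquad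 A(\gamma)=\frac12\int_0^{2T}[\gamma(t),\gamma'(t)]\,dt .$$ Then for every admissible curve $\gamma$, $$L_*(\gamma)^2\ \ge\ 4A(\gamma)A(u),$$ with equality if and only if $\gamma$ is, up to a translation, a multiple of $u$: there are $c\in\mathbb{R}$ and $p\in\mathbb{R}^2$ with $\gamma(t)=c\,u(t)+p$ for all $t\in[0,2T]$. -/

import Mathlib

open Set
open scoped ContDiff

namespace NormedPlane

/-- `[a, b]`: the determinant of the `2 × 2` matrix with columns `a` and `b`. -/
def det (a b : ℝ × ℝ) : ℝ := a.1 * b.2 - a.2 * b.1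

/-- The arc `w|[a,b]` is smooth and strictly convex: `[w', w''] ≠ 0` on the closed interval
(one-sided derivatives at the endpoints). -/
def IsStrictlyConvexArc (w : ℝ → ℝ × ℝ) (a b : ℝ) : Prop :=
  ∀ s ∈ Icc a b,
    det (derivWithin w (Icc a b) s)
      (derivWithin (derivWithin w (Icc a b)) (Icc a b) s) ≠ 0

/-- The arc `w|[a,b]` is a straight segment. -/
def IsStraightArc (w : ℝ → ℝ × ℝ) (a b : ℝ) : Prop :=
  w '' Icc a b = segment ℝ (w a) (w b)

/-- `u : [0, 2T] → ℝ²` is a parameterization of the unit circle `{N = 1}` of the norm `N`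
that is smooth by parts, with `2n` arcs over the intervals `[t i, t (i+1)]`, `i < 2n`. -/
structure IsUnitCircle (N : Seminorm ℝ (ℝ × ℝ)) (T : ℝ) (n : ℕ) (t : ℕ → ℝ)
    (u : ℝ → ℝ × ℝ) : Prop where
  T_pos : 0 < T
  t_zero : t 0 = 0
  t_last : t (2 * n) = 2 * T
  t_lt : ∀ i < 2 * n, t i < t (i + 1)
  closed : u 0 = u (2 * T)
  injOn : InjOn u (Ico 0 (2 * T))
  image_eq : u '' Icc 0 (2 * T) = {x | N x = 1}
  smooth : ∀ i < 2 * n, ContDiffOn ℝ ∞ u (Icc (t i) (t (i + 1)))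
  deriv_ne_zero : ∀ i < 2 * n, ∀ s ∈ Icc (t i) (t (i + 1)),
    derivWithin u (Icc (t i) (t (i + 1))) s ≠ 0
  /-- The `(i+n)`-th arc is the opposite of the `i`-th arc. -/
  symm : ∀ i < n, u '' Icc (t (i + n)) (t (i + n + 1)) =
    (fun x => -x) '' (u '' Icc (t i) (t (i + 1)))
  /-- Every arc is strictly convex or a straight segment. -/
  arcs : ∀ i < 2 * n, IsStrictlyConvexArc u (t i) (t (i + 1)) ∨
    IsStraightArc u (t i) (t (i + 1))
  /-- Two (cyclically) consecutive straight arcs meet at a genuine vertex. -/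
  vertices : ∀ i < 2 * n, ∀ j, j = (i + 1) % (2 * n) →
    IsStraightArc u (t i) (t (i + 1)) → IsStraightArc u (t j) (t (j + 1)) →
    det (u (t (i + 1)) - u (t i)) (u (t (j + 1)) - u (t j)) ≠ 0

/-- `γ : [0, 2T] → ℝ²` is an admissible curve with curvature radius `r`. The values of `r` at the
breakpoints `t i` are immaterial: by continuity the one-sided derivatives of `γ` there are
multiples of those of `u` as well. Over a straight arc of `u`, the curve `γ` is a straight segment
and `r` is the (signed) ratio of the two segments, a constant. -/
structure IsAdmissible (T : ℝ) (n : ℕ) (t : ℕ → ℝ) (u γ : ℝ → ℝ × ℝ) (r : ℝ → ℝ) : Prop where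
  closed : γ 0 = γ (2 * T)
  smooth : ∀ i < 2 * n, ContDiffOn ℝ ∞ γ (Icc (t i) (t (i + 1)))
  deriv_eq : ∀ i < 2 * n, ∀ s ∈ Ioo (t i) (t (i + 1)), deriv γ s = r s • deriv u s
  straight : ∀ i < 2 * n, IsStraightArc u (t i) (t (i + 1)) →
    ∃ c : ℝ, ∀ s ∈ Ioo (t i) (t (i + 1)), r s = c

/-- The signed dual length of an admissible curve with curvature radius `r`. -/
noncomputable def dualLength (T : ℝ) (u : ℝ → ℝ × ℝ) (r : ℝ → ℝ) : ℝ :=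
  ∫ s in (0 : ℝ)..(2 * T), r s * det (u s) (deriv u s)

/-- The mixed area of two curves. -/
noncomputable def mixedArea (T : ℝ) (γ₁ γ₂ : ℝ → ℝ × ℝ) : ℝ :=
  (1 / 2) * ∫ s in (0 : ℝ)..(2 * T), det (γ₁ s) (deriv γ₂ s)

/-- The signed area of a closed curve. -/
noncomputable def area (T : ℝ) (γ : ℝ → ℝ × ℝ) : ℝ := mixedArea T γ γ

end NormedPlane

/-! Take the basis formed by `u(0)` and the one-sided velocity of `u` there. In the coordinates `(x,
y)` of this basis `u` lies in the strip `|x| ≤ 1`, and the points `u(0)` and `-u(0)`, on its two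
sides, cut `u` into two halves. On each half convexity makes the slope `μ = y'/x'` monotone
(`IsUpperHalf.slope_monotone`).

Write `γ = (P, Q)`, `X = P - c x - p` and `Y = Q - c y`, so that `X' = (r - c) x'` and `Y' = (r - c)
y' = μ X'`. Choose `c` and `p` so that `X` vanishes at both cut points. Then on each half `∫ 2 X Y'
= ∫ (X²)' μ = -∫ X² dμ ≤ 0` (`IsConvexLoop.wirtinger`). The slope may blow up at the cut points, but
`X²` vanishes there to second order and the boundary terms disappear (`IsUpperHalf.boundary_le`).
Expanded, the integral over the loop is `A - 2cM + c²D`, where `A`, `M`, `D` are the integrals of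
`[γ, γ']`, `r [u, u']` and `[u, u']` in these coordinates. A quadratic in `c` with `D > 0` that
takes a nonpositive value satisfies `M² ≥ A D`, which is the inequality. Neither convexity of `γ`
nor the sign of `r` plays a role.

In the case of equality `M = c D` and `∫ X² dμ = 0`, so `X = 0` wherever `u` is not locally
straight. Segments do not continue across vertices and `r` is constant on each of them, hence `X =
0` everywhere (`IsAdmissible.coordX_sub_eq_zero`). Then `(r - c) x' = 0`, so `r ≠ c` is possible
only over segments on the lines `x = ±1`, and each line carries at most one
(`IsUnitCircle.flat_arc_unique`). The two relations `M = c D` and `∫ (r - c) y' = 0` exclude both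
(`IsAdmissible.radius_eq`). -/

namespace NormedPlane

open MeasureTheory Filter Topology

/-! ### Primitives with bounded derivative off a countable set -/

/-- `f` is continuous on `[a, b]` and, off the exceptional set `S`, has the bounded derivative
`f'` on `(a, b)`. -/
structure IsPrimitive (S : Set ℝ) (a b : ℝ) (f f' : ℝ → ℝ) : Prop where
  cont : ContinuousOn f (Icc a b)
  deriv : ∀ s ∈ Ioo a b \ S, HasDerivAt f (f' s) s
  bdd : ∃ K, ∀ s ∈ Ioo a b \ S, |f' s| ≤ K

theorem ae_Ioc_of_off_countable {S : Set ℝ} (hS : S.Countable) {a b : ℝ} {P : ℝ → Prop}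
    (h : ∀ s ∈ Ioo a b \ S, P s) : ∀ᵐ s, s ∈ Ioc a b → P s := by
  have h1 : ∀ᵐ s : ℝ, s ∉ insert b S := (hS.insert b).ae_notMem volume
  filter_upwards [h1] with s hs hab
  simp only [mem_insert_iff, not_or] at hs
  exact h s ⟨⟨hab.1, lt_of_le_of_ne hab.2 hs.1⟩, hs.2⟩

theorem integral_congr_off_countable {S : Set ℝ} (hS : S.Countable) {a b : ℝ} (hab : a ≤ b)
    {f g : ℝ → ℝ} (h : ∀ s ∈ Ioo a b \ S, f s = g s) :
    ∫ s in a..b, f s = ∫ s in a..b, g s := by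
  apply intervalIntegral.integral_congr_ae
  rw [uIoc_of_le hab]
  exact ae_Ioc_of_off_countable hS h

theorem intervalIntegrable_congr_off_countable {S : Set ℝ} (hS : S.Countable) {a b : ℝ}
    (hab : a ≤ b) {f g : ℝ → ℝ} (h : ∀ s ∈ Ioo a b \ S, f s = g s)
    (hf : IntervalIntegrable f volume a b) : IntervalIntegrable g volume a b := by
  apply hf.congr_ae
  rw [uIoc_of_le hab]
  exact (ae_restrict_iff' measurableSet_Ioc).2 (ae_Ioc_of_off_countable hS h)

theorem exists_mem_Ioo_notMem {S : Set ℝ} (hS : S.Countable) {a b : ℝ} (hab : a < b) :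
    ∃ s ∈ Ioo a b, s ∉ S := by
  obtain ⟨s, hs, hs'⟩ := (hS.dense_compl ℝ).exists_mem_open isOpen_Ioo (nonempty_Ioo.2 hab)
  exact ⟨s, hs', hs⟩

namespace IsPrimitive

variable {S : Set ℝ} {a b : ℝ} {f f' g g' : ℝ → ℝ}

theorem mono (h : IsPrimitive S a b f f') {c d : ℝ} (hc : a ≤ c) (hd : d ≤ b) :
    IsPrimitive S c d f f' where
  cont := h.cont.mono (Icc_subset_Icc hc hd)
  deriv s hs := h.deriv s ⟨Ioo_subset_Ioo hc hd hs.1, hs.2⟩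
  bdd := h.bdd.imp fun _ hK s hs => hK s ⟨Ioo_subset_Ioo hc hd hs.1, hs.2⟩

theorem congr (h : IsPrimitive S a b f f') (hg : ∀ s ∈ Ioo a b \ S, g' s = f' s) :
    IsPrimitive S a b f g' where
  cont := h.cont
  deriv s hs := by rw [hg s hs]; exact h.deriv s hs
  bdd := h.bdd.imp fun _ hK s hs => by rw [hg s hs]; exact hK s hs

theorem intervalIntegrable (h : IsPrimitive S a b f f') (hS : S.Countable) (hab : a ≤ b) :
    IntervalIntegrable f' volume a b := by
  obtain ⟨K, hK⟩ := h.bdd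
  -- `f'` is not assumed measurable, but off `S` it agrees with `deriv f`, which always is.
  have h1 : IntervalIntegrable (_root_.deriv f) volume a b := by
    rw [intervalIntegrable_iff_integrableOn_Ioc_of_le hab]
    refine IntegrableOn.of_bound measure_Ioc_lt_top (measurable_deriv f).aestronglyMeasurable K ?_
    refine (ae_restrict_iff' measurableSet_Ioc).2 (ae_Ioc_of_off_countable hS fun s hs => ?_)
    rw [(h.deriv s hs).deriv]
    exact hK s hs
  exact intervalIntegrable_congr_off_countable hS hab (fun s hs => (h.deriv s hs).deriv) h1

theorem integral_eq (h : IsPrimitive S a b f f') (hS : S.Countable) (hab : a ≤ b) :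
    ∫ s in a..b, f' s = f b - f a :=
  integral_eq_of_hasDerivAt_off_countable_of_le f f' hab hS h.cont h.deriv
    (h.intervalIntegrable hS hab)

theorem mul_intervalIntegrable (h : IsPrimitive S a b f f') (hS : S.Countable) (hab : a ≤ b)
    (hg : ContinuousOn g (Icc a b)) : IntervalIntegrable (fun s => g s * f' s) volume a b :=
  (h.intervalIntegrable hS hab).continuousOn_mul (by rwa [uIcc_of_le hab])

theorem add (hf : IsPrimitive S a b f f') (hg : IsPrimitive S a b g g') :
    IsPrimitive S a b (fun s => f s + g s) (fun s => f' s + g' s) where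
  cont := hf.cont.add hg.cont
  deriv s hs := (hf.deriv s hs).add (hg.deriv s hs)
  bdd := by
    obtain ⟨K, hK⟩ := hf.bdd
    obtain ⟨L, hL⟩ := hg.bdd
    exact ⟨K + L, fun s hs => (abs_add_le _ _).trans (add_le_add (hK s hs) (hL s hs))⟩

theorem const_mul (hf : IsPrimitive S a b f f') (c : ℝ) :
    IsPrimitive S a b (fun s => c * f s) (fun s => c * f' s) where
  cont := hf.cont.const_mul c
  deriv s hs := (hf.deriv s hs).const_mul c
  bdd := by
    obtain ⟨K, hK⟩ := hf.bdd
    refine ⟨|c| * K, fun s hs => ?_⟩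
    rw [abs_mul]
    exact mul_le_mul_of_nonneg_left (hK s hs) (abs_nonneg c)

theorem add_const (hf : IsPrimitive S a b f f') (c : ℝ) :
    IsPrimitive S a b (fun s => f s + c) f' where
  cont := hf.cont.add continuousOn_const
  deriv s hs := (hf.deriv s hs).add_const c
  bdd := hf.bdd

theorem neg (hf : IsPrimitive S a b f f') :
    IsPrimitive S a b (fun s => -f s) (fun s => -f' s) where
  cont := hf.cont.neg
  deriv s hs := (hf.deriv s hs).neg
  bdd := hf.bdd.imp fun _ hK s hs => by rw [abs_neg]; exact hK s hs

theorem mul (hf : IsPrimitive S a b f f') (hg : IsPrimitive S a b g g') :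
    IsPrimitive S a b (fun s => f s * g s) (fun s => f' s * g s + f s * g' s) where
  cont := hf.cont.mul hg.cont
  deriv s hs := (hf.deriv s hs).mul (hg.deriv s hs)
  bdd := by
    obtain ⟨K, hK⟩ := hf.bdd
    obtain ⟨L, hL⟩ := hg.bdd
    obtain ⟨A, hA⟩ := isCompact_Icc.exists_bound_of_continuousOn hf.cont
    obtain ⟨B, hB⟩ := isCompact_Icc.exists_bound_of_continuousOn hg.cont
    refine ⟨K * B + A * L, fun s hs => ?_⟩
    have h1 := hK s hs
    have h2 := hL s hs
    have h3 : |f s| ≤ A := hA s (Ioo_subset_Icc_self hs.1)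
    have h4 : |g s| ≤ B := hB s (Ioo_subset_Icc_self hs.1)
    refine (abs_add_le _ _).trans (add_le_add ?_ ?_)
    · rw [abs_mul]
      exact mul_le_mul h1 h4 (abs_nonneg _) ((abs_nonneg _).trans h1)
    · rw [abs_mul]
      exact mul_le_mul h3 h2 (abs_nonneg _) ((abs_nonneg _).trans h3)

theorem sub_le_of_le (h : IsPrimitive S a b f f') (hS : S.Countable) (hab : a ≤ b)
    (hf : ∀ s ∈ Ioo a b \ S, f' s ≤ 0) : f b ≤ f a := by
  have h1 := h.integral_eq hS hab
  have h2 : 0 ≤ ∫ s in a..b, -f' s := by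
    apply intervalIntegral.integral_nonneg_of_ae_restrict hab
    refine (ae_restrict_iff' measurableSet_Icc).2 ?_
    have h3 : ∀ᵐ s : ℝ, s ∉ ({a} : Set ℝ) := (countable_singleton a).ae_notMem volume
    filter_upwards [h3, ae_Ioc_of_off_countable hS hf] with s hs hs' hs''
    have := hs' ⟨lt_of_le_of_ne hs''.1 (Ne.symm hs), hs''.2⟩
    simpa using this
  rw [intervalIntegral.integral_neg] at h2
  linarith

theorem antitoneOn (h : IsPrimitive S a b f f') (hS : S.Countable)
    (hf : ∀ s ∈ Ioo a b \ S, f' s ≤ 0) : AntitoneOn f (Icc a b) := fun _ hp _ hq hpq =>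
  (h.mono hp.1 hq.2).sub_le_of_le hS hpq fun s hs => hf s ⟨Ioo_subset_Ioo hp.1 hq.2 hs.1, hs.2⟩

theorem eq_of_deriv_eq_zero (h : IsPrimitive S a b f f') (hS : S.Countable)
    (hf : ∀ s ∈ Ioo a b \ S, f' s = 0) {p : ℝ} (hp : p ∈ Icc a b) : f p = f a := by
  have h1 := (h.mono le_rfl hp.2).integral_eq hS hp.1
  rw [integral_congr_off_countable hS hp.1 (g := fun _ => 0)
    (fun s hs => hf s ⟨Ioo_subset_Ioo le_rfl hp.2 hs.1, hs.2⟩)] at h1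
  simp at h1
  linarith

/-! ### Integration by parts against a monotone function -/

theorem mul_monotone_intervalIntegrable (h : IsPrimitive S a b f f') (hS : S.Countable)
    (hab : a ≤ b) {M : ℝ → ℝ} (hM : Monotone M) :
    IntervalIntegrable (fun s => f' s * M s) volume a b := by
  have hi := h.intervalIntegrable hS hab
  rw [intervalIntegrable_iff_integrableOn_Ioc_of_le hab] at hi ⊢
  refine Integrable.mul_bdd (c := |M a| + |M b|) hi hM.measurable.aestronglyMeasurable ?_
  refine (ae_restrict_iff' measurableSet_Ioc).2 (ae_of_all _ fun s hs => ?_)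
  have h1 := hM hs.1.le
  have h2 := hM hs.2
  rw [Real.norm_eq_abs, abs_le]
  constructor <;> cases abs_cases (M a) <;> cases abs_cases (M b) <;> linarith

/-- A quantitative form of integration by parts against a monotone function. -/
theorem le_stieltjes (h : IsPrimitive S a b f f') (hS : S.Countable) (hab : a ≤ b)
    {M : ℝ → ℝ} (hM : Monotone M) {K : ℝ} (hK : ∀ s ∈ Ioo a b \ S, |f' s| ≤ K) :
    (f a - K * (b - a)) * (M b - M a) ≤ f b * M b - f a * M a - ∫ s in a..b, f' s * M s := by
  have hi := h.intervalIntegrable hS hab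
  have hMi := h.mul_monotone_intervalIntegrable hS hab hM
  -- The boundary expression is `f a * (M b - M a)` plus this integral, an error of at most `K (b -
  -- a) (M b - M a)`.
  have h1 : ∫ s in a..b, f' s * (M b - M s) = (f b - f a) * M b - ∫ s in a..b, f' s * M s := by
    rw [← h.integral_eq hS hab, ← intervalIntegral.integral_mul_const,
      ← intervalIntegral.integral_sub (hi.mul_const _) hMi]
    congr 1
    ext s
    ring
  have h2 : |∫ s in a..b, f' s * (M b - M s)| ≤ (K * (M b - M a)) * |b - a| := by
    rw [← Real.norm_eq_abs]
    apply intervalIntegral.norm_integral_le_of_norm_le_const_ae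
    rw [uIoc_of_le hab]
    refine ae_Ioc_of_off_countable hS fun s hs => ?_
    have h3 := hM hs.1.1.le
    have h4 := hM hs.1.2.le
    rw [Real.norm_eq_abs, abs_mul, abs_of_nonneg (sub_nonneg.2 h4)]
    exact mul_le_mul (hK s hs) (by linarith) (by linarith) ((abs_nonneg _).trans (hK s hs))
  rw [abs_of_nonneg (sub_nonneg.2 hab), h1] at h2
  have h3 := (abs_le.1 h2).1
  nlinarith [h3]

/-- Integration by parts against a monotone function: for `f ≥ 0`,
`∫ f' M ≤ f b M b - f a M a`. -/
theorem stieltjes_nonneg (h : IsPrimitive S a b f f') (hS : S.Countable) (hab : a ≤ b)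
    {M : ℝ → ℝ} (hM : Monotone M) (hf : ∀ s ∈ Icc a b, 0 ≤ f s) :
    0 ≤ f b * M b - f a * M a - ∫ s in a..b, f' s * M s := by
  obtain ⟨K, hK⟩ := h.bdd
  -- The expression plays the part of `∫ f dM`. On `N` equal pieces the main terms of `le_stieltjes`
  -- are nonnegative, and the errors telescope to a total of order `1 / N`.
  have key : ∀ N : ℕ, 0 < N → -(K * (b - a) * (M b - M a)) / N ≤
      f b * M b - f a * M a - ∫ s in a..b, f' s * M s := by
    intro N hN
    have hN' : (0 : ℝ) < N := Nat.cast_pos.2 hN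
    set p : ℕ → ℝ := fun k => a + k * ((b - a) / N) with hp
    have hδ : 0 ≤ (b - a) / N := div_nonneg (sub_nonneg.2 hab) hN'.le
    have hp0 : p 0 = a := by simp [hp]
    have hpN : p N = b := by simp only [hp]; field_simp; ring
    have hpm : Monotone p := fun i j hij => by
      simp only [hp]
      have : (i : ℝ) ≤ j := Nat.cast_le.2 hij
      gcongr
    have hpk : ∀ k < N, p k ∈ Icc a b ∧ p (k + 1) ∈ Icc a b := fun k hk =>
      ⟨⟨hp0 ▸ hpm k.zero_le, hpN ▸ hpm hk.le⟩, ⟨hp0 ▸ hpm (Nat.zero_le _), hpN ▸ hpm hk⟩⟩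
    have hsub : ∀ k < N, IsPrimitive S (p k) (p (k + 1)) f f' := fun k hk =>
      h.mono (hpk k hk).1.1 (hpk k hk).2.2
    have hint : ∑ k ∈ Finset.range N, ∫ s in p k..p (k + 1), f' s * M s =
        ∫ s in a..b, f' s * M s := by
      rw [← hp0, ← hpN]
      exact intervalIntegral.sum_integral_adjacent_intervals fun k hk =>
        (hsub k hk).mul_monotone_intervalIntegrable hS (hpm k.le_succ) hM
    have h1 : ∑ k ∈ Finset.range N, -(K * ((b - a) / N)) * (M (p (k + 1)) - M (p k)) ≤
        ∑ k ∈ Finset.range N, ((f (p (k + 1)) * M (p (k + 1)) - f (p k) * M (p k)) -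
          ∫ s in p k..p (k + 1), f' s * M s) := by
      refine Finset.sum_le_sum fun k hk => ?_
      have hk' := Finset.mem_range.1 hk
      have h2 := (hsub k hk').le_stieltjes hS (hpm k.le_succ) hM (K := K) fun s hs =>
        hK s ⟨Ioo_subset_Ioo (hpk k hk').1.1 (hpk k hk').2.2 hs.1, hs.2⟩
      have h3 : p (k + 1) - p k = (b - a) / N := by simp only [hp]; push_cast; ring
      rw [h3] at h2
      have h4 := hM (hpm k.le_succ)
      have h5 := mul_nonneg (hf _ (hpk k hk').1) (sub_nonneg.2 h4)
      simp only [Nat.succ_eq_add_one] at h5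
      linarith
    rw [← Finset.mul_sum, Finset.sum_range_sub (fun k => M (p k)), Finset.sum_sub_distrib, hint,
      Finset.sum_range_sub (fun k => f (p k) * M (p k)), hp0, hpN] at h1
    calc _ = _ := by ring
      _ ≤ _ := h1
  by_contra hneg
  push Not at hneg
  obtain ⟨N, hN⟩ := exists_nat_gt (|K * (b - a) * (M b - M a)| /
    -(f b * M b - f a * M a - ∫ s in a..b, f' s * M s))
  have hN0 : (0 : ℝ) < N := lt_of_le_of_lt (div_nonneg (abs_nonneg _) (by linarith)) hN
  have h1 := key N (Nat.cast_pos.1 hN0)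
  rw [div_lt_iff₀ (by linarith)] at hN
  rw [div_le_iff₀ hN0] at h1
  have := le_abs_self (K * (b - a) * (M b - M a))
  linarith

/-- If there is equality in `stieltjes_nonneg` then `M` is locally constant where `f > 0`. -/
theorem eventuallyConst_of_stieltjes_eq_zero (h : IsPrimitive S a b f f') (hS : S.Countable)
    {M : ℝ → ℝ} (hM : Monotone M) (hf : ∀ s ∈ Icc a b, 0 ≤ f s)
    (h0 : f b * M b - f a * M a - ∫ s in a..b, f' s * M s ≤ 0) {s : ℝ} (hs : s ∈ Ioo a b)
    (hfs : 0 < f s) :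
    ∃ δ > 0, ∀ p ∈ Ioo (s - δ) (s + δ), ∀ q ∈ Ioo (s - δ) (s + δ), M p = M q := by
  have hab : a ≤ b := (hs.1.trans hs.2).le
  obtain ⟨K, hK⟩ := h.bdd
  have hK' : ∀ s ∈ Ioo a b \ S, |f' s| ≤ |K| + 1 := fun s hs =>
    (hK s hs).trans ((le_abs_self K).trans (by linarith))
  have hKpos : 0 < |K| + 1 := by positivity
  have hcont : ContinuousAt f s := h.cont.continuousAt (Icc_mem_nhds hs.1 hs.2)
  have hev : ∀ᶠ x in 𝓝 s, f s / 2 < f x ∧ x ∈ Ioo a b :=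
    (hcont.eventually (lt_mem_nhds (by linarith : f s / 2 < f s))).and (Ioo_mem_nhds hs.1 hs.2)
  obtain ⟨δ₁, hδ₁, hball⟩ := Metric.eventually_nhds_iff.1 hev
  -- Near `s` one has `f > f s / 2`, and the second bound gives `(|K| + 1) * 2δ ≤ f s / 2`, so the
  -- factor of `M q - M p` in `le_stieltjes` stays positive.
  set δ := min δ₁ (f s / (4 * (|K| + 1))) with hδ
  have hδpos : 0 < δ := lt_min hδ₁ (by positivity)
  have hin : ∀ x ∈ Ioo (s - δ) (s + δ), f s / 2 < f x ∧ x ∈ Ioo a b := fun x hx => by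
    refine hball ((?_ : dist x s < δ).trans_le (min_le_left _ _))
    rw [Real.dist_eq, abs_lt]
    constructor <;> linarith [hx.1, hx.2]
  have hδK : δ * (4 * (|K| + 1)) ≤ f s := by
    rw [← le_div_iff₀ (by positivity)]
    exact min_le_right _ _
  have main : ∀ p ∈ Ioo (s - δ) (s + δ), ∀ q ∈ Ioo (s - δ) (s + δ), p ≤ q → M p = M q := by
    intro p hp q hq hpq
    obtain ⟨hp1, hp2⟩ := hin p hp
    obtain ⟨-, hq2⟩ := hin q hq
    -- The defect is additive over intervals and nonnegative on the two outer ones, so it is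
    -- nonpositive on `[p, q]`.
    have e1 := (h.mono le_rfl hp2.2.le).stieltjes_nonneg hS hp2.1.le hM
      fun s hs => hf s ⟨hs.1, hs.2.trans hp2.2.le⟩
    have e2 := (h.mono hq2.1.le le_rfl).stieltjes_nonneg hS hq2.2.le hM
      fun s hs => hf s ⟨hq2.1.le.trans hs.1, hs.2⟩
    have e3 := (h.mono hp2.1.le hq2.2.le).le_stieltjes hS hpq hM (K := |K| + 1)
      fun s hs => hK' s ⟨Ioo_subset_Ioo hp2.1.le hq2.2.le hs.1, hs.2⟩
    have i1 := (h.mono le_rfl hp2.2.le).mul_monotone_intervalIntegrable hS hp2.1.le hM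
    have i2 := (h.mono hp2.1.le hq2.2.le).mul_monotone_intervalIntegrable hS hpq hM
    have i3 := (h.mono hq2.1.le le_rfl).mul_monotone_intervalIntegrable hS hq2.2.le hM
    have e4 := intervalIntegral.integral_add_adjacent_intervals i1 i2
    have e5 := intervalIntegral.integral_add_adjacent_intervals (i1.trans i2) i3
    have e6 : (f p - (|K| + 1) * (q - p)) * (M q - M p) ≤ 0 := by linarith
    have e7 : (|K| + 1) * (q - p) ≤ (|K| + 1) * (2 * δ) :=
      mul_le_mul_of_nonneg_left (by linarith [hp.1, hq.2]) hKpos.le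
    have e8 : 0 < f p - (|K| + 1) * (q - p) := by linarith
    have e9 := hM hpq
    have e10 : M q - M p ≤ 0 := nonpos_of_mul_nonpos_right e6 e8
    linarith
  refine ⟨δ, hδpos, fun p hp q hq => ?_⟩
  rcases le_total p q with hpq | hpq
  · exact main p hp q hq hpq
  · exact (main q hq p hp hpq).symm

end IsPrimitive

/-! ### Wirtinger's inequality on a half curve -/

/-- The upper half, from `(1, 0)` to `(-1, 0)`, of a convex curve with supporting lines `x = 1`
and `x = -1` at its endpoints. -/
structure IsUpperHalf (S : Set ℝ) (a b : ℝ) (x x' y y' : ℝ → ℝ) : Prop where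
  lt : a < b
  countable : S.Countable
  hx : IsPrimitive S a b x x'
  hy : IsPrimitive S a b y y'
  x_left : x a = 1
  y_left : y a = 0
  x_right : x b = -1
  y_right : y b = 0
  abs_x_le : ∀ s ∈ Icc a b, |x s| ≤ 1
  y_pos : ∀ s ∈ Ioo a b, 0 < y s
  support : ∀ s ∈ Ioo a b \ S, ∀ σ ∈ Icc a b,
    x σ * y' s - y σ * x' s ≤ x s * y' s - y s * x' s
  det_pos : ∀ s ∈ Ioo a b \ S, 0 < x s * y' s - y s * x' s

namespace IsUpperHalf

variable {S : Set ℝ} {a b : ℝ} {x x' y y' : ℝ → ℝ}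

/-- The supporting line at `s`, tested at the endpoint `(1, 0)`. Where `x' < 0` and `|x| < 1`, this
and `support_right` confine the slope `y'/x'` between `-y/(1 - x)` and `y/(1 + x)`. -/
theorem support_left (h : IsUpperHalf S a b x x' y y') {s : ℝ} (hs : s ∈ Ioo a b \ S) :
    (1 - x s) * y' s ≤ -(y s * x' s) := by
  have := h.support s hs a (left_mem_Icc.2 h.lt.le)
  rw [h.x_left, h.y_left] at this
  linarith

theorem support_right (h : IsUpperHalf S a b x x' y y') {s : ℝ} (hs : s ∈ Ioo a b \ S) :
    -((1 + x s) * y' s) ≤ -(y s * x' s) := by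
  have := h.support s hs b (right_mem_Icc.2 h.lt.le)
  rw [h.x_right, h.y_right] at this
  linarith

/-- If `x'` were positive while `y > 0`, one of the endpoints `(±1, 0)`, depending on the sign of
`y'`, would lie on the wrong side of the tangent line. -/
theorem deriv_nonpos_of_abs_le (h : IsUpperHalf S a b x x' y y') {s : ℝ} (hs : s ∈ Ioo a b \ S)
    (hxs : |x s| ≤ 1) : x' s ≤ 0 := by
  have h1 := h.support_left hs
  have h2 := h.support_right hs
  have h3 := h.y_pos s hs.1
  obtain ⟨h4, h5⟩ := abs_le.1 hxs
  by_contra hneg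
  push Not at hneg
  have h6 := mul_pos h3 hneg
  rcases le_total 0 (y' s) with h7 | h7
  · nlinarith [mul_nonneg (sub_nonneg.2 h5) h7]
  · nlinarith [mul_nonneg (by linarith : 0 ≤ 1 + x s) (neg_nonneg.2 h7)]

/-- A vertical tangent strictly inside the strip would separate the two endpoints unless `y' = 0`,
and `det_pos` excludes a vanishing velocity. -/
theorem deriv_neg (h : IsUpperHalf S a b x x' y y') {s : ℝ} (hs : s ∈ Ioo a b \ S)
    (hxs : |x s| < 1) : x' s < 0 := by
  refine lt_of_le_of_ne (h.deriv_nonpos_of_abs_le hs hxs.le) fun h0 => ?_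
  have h1 := h.support_left hs
  have h2 := h.support_right hs
  have h3 := h.det_pos s hs
  obtain ⟨h4, h5⟩ := abs_lt.1 hxs
  rw [h0] at h1 h2 h3
  have h6 : y' s ≤ 0 := by
    by_contra hn
    nlinarith [mul_pos (sub_pos.2 h5) (not_le.1 hn)]
  have h7 : 0 ≤ y' s := by
    by_contra hn
    nlinarith [mul_pos (by linarith : 0 < 1 + x s) (neg_pos.2 (not_le.1 hn))]
  rw [le_antisymm h6 h7] at h3
  simp at h3

theorem antitoneOn (h : IsUpperHalf S a b x x' y y') :
    AntitoneOn x (Icc a b) :=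
  h.hx.antitoneOn h.countable fun s hs =>
    h.deriv_nonpos_of_abs_le hs (h.abs_x_le s (Ioo_subset_Icc_self hs.1))

/-- Convexity without second derivatives: the support inequalities of `p` and `q`, each tested at
the other point, combine so that the ordinates cancel and the slopes are compared. -/
theorem slope_monotone (h : IsUpperHalf S a b x x' y y')
    {p q : ℝ} (hp : p ∈ Ioo a b \ S) (hq : q ∈ Ioo a b \ S) (hxp : |x p| < 1) (hxq : |x q| < 1)
    (hpq : p ≤ q) : y' p / x' p ≤ y' q / x' q := by
  rcases hpq.eq_or_lt with rfl | hpq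
  · rfl
  have hanti := h.antitoneOn
  have hlt : x q < x p := by
    -- Equality would make the antitone `x` constant between `p` and `q`, where its derivative is
    -- negative.
    refine lt_of_le_of_ne (hanti (Ioo_subset_Icc_self hp.1) (Ioo_subset_Icc_self hq.1) hpq.le)
      fun heq => ?_
    obtain ⟨s, hs, hsS⟩ := exists_mem_Ioo_notMem h.countable hpq
    have hsub : Ioo p q ⊆ Ioo a b := Ioo_subset_Ioo hp.1.1.le hq.1.2.le
    have hconst : ∀ z ∈ Ioo p q, x z = x p := fun z hz => by
      have h1 := hanti (Ioo_subset_Icc_self hp.1) (Ioo_subset_Icc_self (hsub hz)) hz.1.le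
      have h2 := hanti (Ioo_subset_Icc_self (hsub hz)) (Ioo_subset_Icc_self hq.1) hz.2.le
      linarith
    have h1 : HasDerivAt x 0 s := by
      refine (hasDerivAt_const s (x p)).congr_of_eventuallyEq ?_
      filter_upwards [Ioo_mem_nhds hs.1 hs.2] with z hz using hconst z hz
    have h2 := h.hx.deriv s ⟨hsub hs, hsS⟩
    have h3 := h.deriv_neg ⟨hsub hs, hsS⟩ (by rw [hconst s hs]; exact hxp)
    linarith [h1.unique h2]
  have hp' := h.deriv_neg hp hxp
  have hq' := h.deriv_neg hq hxq
  have s1 := h.support p hp q (Ioo_subset_Icc_self hq.1)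
  have s2 := h.support q hq p (Ioo_subset_Icc_self hp.1)
  rw [div_le_iff_of_neg hp', div_mul_eq_mul_div, div_le_iff_of_neg hq']
  have s3 := mul_le_mul_of_nonneg_right s1 (neg_pos.2 hq').le
  have s4 := mul_le_mul_of_nonneg_right s2 (neg_pos.2 hp').le
  have s5 : (x p - x q) * (y' p * x' q - y' q * x' p) ≤ 0 := by linarith
  have s6 := nonpos_of_mul_nonpos_right s5 (sub_pos.2 hlt)
  linarith

variable {X Y ρ : ℝ → ℝ} {C : ℝ}

/-- Since `x' ≤ 0` and `|ρ| ≤ C`, both `C x + X` and `C x - X` are antitone; compare their values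
with those at the two ends. Hence `X` vanishes at least linearly in the distance to the lines `x =
±1`. -/
theorem abs_le_mul_sub (h : IsUpperHalf S a b x x' y y')
    (hX : IsPrimitive S a b X (fun s => ρ s * x' s)) (hρ : ∀ s ∈ Ioo a b \ S, |ρ s| ≤ C)
    (hXa : X a = 0) (hXb : X b = 0) {s : ℝ} (hs : s ∈ Icc a b) :
    |X s| ≤ C * (1 - x s) ∧ |X s| ≤ C * (1 + x s) := by
  have hd : ∀ s ∈ Ioo a b \ S, x' s ≤ 0 := fun s hs =>
    h.deriv_nonpos_of_abs_le hs (h.abs_x_le s (Ioo_subset_Icc_self hs.1))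
  have h1 := ((h.hx.const_mul C).add hX).antitoneOn h.countable fun s hs => by
    have := (abs_le.1 (hρ s hs)).1
    nlinarith [hd s hs]
  have h2 := ((h.hx.const_mul C).add hX.neg).antitoneOn h.countable fun s hs => by
    have := (abs_le.1 (hρ s hs)).2
    nlinarith [hd s hs]
  have ha := left_mem_Icc.2 h.lt.le
  have hb := right_mem_Icc.2 h.lt.le
  have e1 := h1 ha hs hs.1
  have e2 := h1 hs hb hs.2
  have e3 := h2 ha hs hs.1
  have e4 := h2 hs hb hs.2
  simp only [hXa, hXb, h.x_left, h.x_right] at e1 e2 e3 e4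
  constructor <;> rw [abs_le] <;> constructor <;> linarith

/-- The slope is controlled only off `S` and may be unbounded at the ends. Restricted to `[p, q]` it
is bounded by its values at `p` and `q`, so it extends to a monotone function on the line. -/
theorem exists_monotone_slope (h : IsUpperHalf S a b x x' y y') {p q : ℝ}
    (hp : p ∈ Ioo a b \ S) (hq : q ∈ Ioo a b \ S)
    (hxp : |x p| < 1) (hxq : |x q| < 1) (hpq : p ≤ q) :
    ∃ M : ℝ → ℝ, Monotone M ∧ ∀ s ∈ Icc p q \ S, s ∈ Ioo a b ∧ |x s| < 1 ∧ M s = y' s / x' s := by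
  have hanti := h.antitoneOn
  have hsub : Icc p q ⊆ Ioo a b := fun s hs => ⟨hp.1.1.trans_le hs.1, hs.2.trans_lt hq.1.2⟩
  have hlt : ∀ s ∈ Icc p q, |x s| < 1 := fun s hs => by
    have h1 := hanti (Ioo_subset_Icc_self hp.1) (Ioo_subset_Icc_self (hsub hs)) hs.1
    have h2 := hanti (Ioo_subset_Icc_self (hsub hs)) (Ioo_subset_Icc_self hq.1) hs.2
    rw [abs_lt] at hxp hxq ⊢
    constructor <;> linarith
  have hmono : MonotoneOn (fun s => y' s / x' s) (Icc p q \ S) := fun s hs σ hσ hsσ =>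
    h.slope_monotone ⟨hsub hs.1, hs.2⟩ ⟨hsub hσ.1, hσ.2⟩ (hlt s hs.1) (hlt σ hσ.1) hsσ
  obtain ⟨M, hM, hMeq⟩ := hmono.exists_monotone_extension
    ⟨_, by rintro _ ⟨s, hs, rfl⟩; exact hmono ⟨left_mem_Icc.2 hpq, hp.2⟩ hs hs.1.1⟩
    ⟨_, by rintro _ ⟨s, hs, rfl⟩; exact hmono hs ⟨right_mem_Icc.2 hpq, hq.2⟩ hs.1.2⟩
  exact ⟨M, hM, fun s hs => ⟨hsub hs.1, hlt s hs.1, (hMeq hs).symm⟩⟩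

/-- The substitution `y' = M x'` turns `2 X Y'` into `(X²)' M`, to which
`IsPrimitive.stieltjes_nonneg` applies. -/
theorem integral_eq_slope_integral (h : IsUpperHalf S a b x x' y y') {p q : ℝ} (hpq : p ≤ q)
    {M : ℝ → ℝ} (hM : ∀ s ∈ Icc p q \ S, s ∈ Ioo a b ∧ |x s| < 1 ∧ M s = y' s / x' s) :
    ∫ s in p..q, 2 * X s * (ρ s * y' s) =
      ∫ s in p..q, (ρ s * x' s * X s + X s * (ρ s * x' s)) * M s := by
  refine integral_congr_off_countable h.countable hpq fun s hs => ?_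
  obtain ⟨h1, h2, h3⟩ := hM s ⟨Ioo_subset_Icc_self hs.1, hs.2⟩
  have h4 := (h.deriv_neg ⟨h1, hs.2⟩ h2).ne
  rw [h3]
  field_simp
  ring

/-- The expression is `∫ X² dM` for the monotone slope `M`, after integration by parts. -/
theorem defect_nonneg (h : IsUpperHalf S a b x x' y y')
    (hX : IsPrimitive S a b X (fun s => ρ s * x' s)) {p q : ℝ} (hp : p ∈ Ioo a b \ S)
    (hq : q ∈ Ioo a b \ S) (hxp : |x p| < 1) (hxq : |x q| < 1) (hpq : p ≤ q) :
    0 ≤ X q * X q * (y' q / x' q) - X p * X p * (y' p / x' p) -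
      ∫ s in p..q, 2 * X s * (ρ s * y' s) := by
  obtain ⟨M, hM, hMeq⟩ := h.exists_monotone_slope hp hq hxp hxq hpq
  rw [h.integral_eq_slope_integral hpq hMeq,
    ← (hMeq p ⟨left_mem_Icc.2 hpq, hp.2⟩).2.2, ← (hMeq q ⟨right_mem_Icc.2 hpq, hq.2⟩).2.2]
  exact ((hX.mul hX).mono hp.1.1.le hq.1.2.le).stieltjes_nonneg h.countable hpq hM
    fun s _ => mul_self_nonneg _

/-- `X²` is of second order in the distance to either line `x = ±1`, whereas the slope is at most
`y/(1 + x)` and its negative at most `y/(1 - x)`. Only one sign of the boundary term has to be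
controlled at each end. -/
theorem boundary_le (h : IsUpperHalf S a b x x' y y')
    (hX : IsPrimitive S a b X (fun s => ρ s * x' s)) (hρ : ∀ s ∈ Ioo a b \ S, |ρ s| ≤ C)
    (hXa : X a = 0) (hXb : X b = 0) {s : ℝ} (hs : s ∈ Ioo a b \ S) (hxs : |x s| < 1) :
    X s * X s * (y' s / x' s) ≤ C ^ 2 * (1 + x s) * y s ∧
      -(X s * X s * (y' s / x' s)) ≤ C ^ 2 * (1 - x s) * y s := by
  obtain ⟨h1, h2⟩ := h.abs_le_mul_sub hX hρ hXa hXb (Ioo_subset_Icc_self hs.1)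
  have h3 := h.deriv_neg hs hxs
  obtain ⟨h4, h5⟩ := abs_lt.1 hxs
  have h6 : 0 < 1 - x s := by linarith
  have h7 : 0 < 1 + x s := by linarith
  have hy := h.y_pos s hs.1
  have sq1 : X s * X s ≤ C ^ 2 * (1 - x s) ^ 2 := by
    rw [← abs_mul_abs_self, ← mul_pow, sq]
    exact mul_le_mul h1 h1 (abs_nonneg _) ((abs_nonneg _).trans h1)
  have sq2 : X s * X s ≤ C ^ 2 * (1 + x s) ^ 2 := by
    rw [← abs_mul_abs_self, ← mul_pow, sq]
    exact mul_le_mul h2 h2 (abs_nonneg _) ((abs_nonneg _).trans h2)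
  have m1 : -(y' s / x' s) * (1 - x s) ≤ y s := by
    rw [neg_mul, div_mul_eq_mul_div, ← neg_div, div_le_iff_of_neg h3]
    linarith [h.support_left hs]
  have m2 : (y' s / x' s) * (1 + x s) ≤ y s := by
    rw [div_mul_eq_mul_div, div_le_iff_of_neg h3]
    linarith [h.support_right hs]
  have hCC : 0 ≤ C ^ 2 := sq_nonneg C
  have hXX := mul_self_nonneg (X s)
  constructor
  · have e1 : 0 ≤ C ^ 2 * (1 + x s) * y s := by positivity
    rcases le_total (y' s / x' s) 0 with hm | hm
    · exact (mul_nonpos_of_nonneg_of_nonpos hXX hm).trans e1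
    · calc _ ≤ C ^ 2 * (1 + x s) ^ 2 * (y' s / x' s) := mul_le_mul_of_nonneg_right sq2 hm
        _ = C ^ 2 * (1 + x s) * ((y' s / x' s) * (1 + x s)) := by ring
        _ ≤ _ := mul_le_mul_of_nonneg_left m2 (by positivity)
  · have e1 : 0 ≤ C ^ 2 * (1 - x s) * y s := by positivity
    rcases le_total 0 (y' s / x' s) with hm | hm
    · exact (neg_nonpos.2 (mul_nonneg hXX hm)).trans e1
    · calc -(X s * X s * (y' s / x' s)) = X s * X s * -(y' s / x' s) := by ring
        _ ≤ C ^ 2 * (1 - x s) ^ 2 * -(y' s / x' s) :=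
          mul_le_mul_of_nonneg_right sq1 (neg_nonneg.2 hm)
        _ = C ^ 2 * (1 - x s) * (-(y' s / x' s) * (1 - x s)) := by ring
        _ ≤ _ := mul_le_mul_of_nonneg_left m1 (by positivity)

theorem exists_near (h : IsUpperHalf S a b x x' y y') {v w : ℝ} (hv : -1 ≤ v) (hvw : v < w)
    (hw : w ≤ 1) : ∃ s ∈ Ioo a b \ S, v < x s ∧ x s < w := by
  obtain ⟨p, hp, hpx⟩ : (v + w) / 2 ∈ x '' Icc a b :=
    intermediate_value_Icc' h.lt.le h.hx.cont (by
      rw [h.x_left, h.x_right]; constructor <;> linarith)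
  have hpa : p ≠ a := by rintro rfl; rw [h.x_left] at hpx; linarith
  have hpb : p ≠ b := by rintro rfl; rw [h.x_right] at hpx; linarith
  have hp' : p ∈ Ioo a b := ⟨lt_of_le_of_ne hp.1 (Ne.symm hpa), lt_of_le_of_ne hp.2 hpb⟩
  have hev : ∀ᶠ s in 𝓝 p, s ∈ Ioo a b ∧ x s ∈ Ioo v w :=
    Filter.Eventually.and (Ioo_mem_nhds hp'.1 hp'.2) ((h.hx.cont.continuousAt (Icc_mem_nhds hp'.1 hp'.2)).eventually
      (Ioo_mem_nhds (by linarith) (by linarith)))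
  obtain ⟨U, hU, hUo, hpU⟩ := eventually_nhds_iff.1 hev
  obtain ⟨s, hs, hsU⟩ := (h.countable.dense_compl ℝ).exists_mem_open hUo ⟨p, hpU⟩
  exact ⟨s, ⟨(hU s hsU).1, hs⟩, (hU s hsU).2⟩

/-- The defect over a subinterval is at most that over the whole half curve. -/
theorem defect_le (h : IsUpperHalf S a b x x' y y')
    (hX : IsPrimitive S a b X (fun s => ρ s * x' s))
    (hY : IsPrimitive S a b Y (fun s => ρ s * y' s)) (hρ : ∀ s ∈ Ioo a b \ S, |ρ s| ≤ C)
    (hXa : X a = 0) (hXb : X b = 0) {p q : ℝ} (hp : p ∈ Ioo a b \ S)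
    (hq : q ∈ Ioo a b \ S) (hxp : |x p| < 1) (hxq : |x q| < 1) (hpq : p ≤ q) :
    X q * X q * (y' q / x' q) - X p * X p * (y' p / x' p) -
      ∫ s in p..q, 2 * X s * (ρ s * y' s) ≤ -∫ s in a..b, 2 * X s * (ρ s * y' s) := by
  obtain ⟨K, hK⟩ := hY.bdd
  obtain ⟨B, hB⟩ := isCompact_Icc.exists_bound_of_continuousOn h.hy.cont
  have hanti := h.antitoneOn
  have hC : 0 ≤ C := (abs_nonneg _).trans (hρ p hp)
  have hK0 : 0 ≤ K := (abs_nonneg _).trans (hK p hp)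
  have hB0 : 0 ≤ B := (norm_nonneg _).trans (hB p (Ioo_subset_Icc_self hp.1))
  have hint : ∀ c d, a ≤ c → c ≤ d → d ≤ b →
      IntervalIntegrable (fun s => 2 * X s * (ρ s * y' s)) volume c d := fun c d hac hcd hdb =>
    (hY.mono hac hdb).mul_intervalIntegrable h.countable hcd
      ((hX.cont.mono (Icc_subset_Icc hac hdb)).const_mul 2)
  -- `D η` collects two boundary terms, at most `C² η B` each, and two end integrals, at most `2 C η
  -- K (b - a)` each.
  set D := 2 * C ^ 2 * B + 4 * C * K * (b - a) with hD
  have hD0 : 0 ≤ D := by have := h.lt; have : 0 ≤ b - a := by linarith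
                         positivity
  refine le_of_forall_pos_le_add fun ε hε => ?_
  -- The first two bounds put the auxiliary points `p₁`, `q₁` outside `[p, q]`; the third makes the
  -- total error at most `ε`.
  set η := min (min (1 - x p) (1 + x q)) (ε / (D + 1)) with hη
  obtain ⟨hxp1, hxp2⟩ := abs_lt.1 hxp
  obtain ⟨hxq1, hxq2⟩ := abs_lt.1 hxq
  have hη0 : 0 < η := lt_min (lt_min (by linarith) (by linarith)) (by positivity)
  have hη1 : η ≤ 1 - x p := (min_le_left _ _).trans (min_le_left _ _)
  have hη2 : η ≤ 1 + x q := (min_le_left _ _).trans (min_le_right _ _)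
  have hηε : D * η ≤ ε := by
    have h1 : η ≤ ε / (D + 1) := min_le_right _ _
    rw [le_div_iff₀ (by linarith)] at h1
    nlinarith
  obtain ⟨p₁, hp₁, hp₁x, hp₁x'⟩ := h.exists_near (v := 1 - η) (w := 1) (by linarith) (by linarith)
    le_rfl
  obtain ⟨q₁, hq₁, hq₁x, hq₁x'⟩ := h.exists_near (v := -1) (w := -1 + η) le_rfl (by linarith)
    (by linarith)
  have hpp : p₁ ≤ p := by
    by_contra hn
    have := hanti (Ioo_subset_Icc_self hp.1) (Ioo_subset_Icc_self hp₁.1) (not_le.1 hn).le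
    linarith
  have hqq : q ≤ q₁ := by
    by_contra hn
    have := hanti (Ioo_subset_Icc_self hq₁.1) (Ioo_subset_Icc_self hq.1) (not_le.1 hn).le
    linarith
  have hxp₁ : |x p₁| < 1 := abs_lt.2 ⟨by linarith, hp₁x'⟩
  have hxq₁ : |x q₁| < 1 := abs_lt.2 ⟨hq₁x, by linarith⟩
  have d1 := h.defect_nonneg hX hp₁ hp hxp₁ hxp hpp
  have d2 := h.defect_nonneg hX hq hq₁ hxq hxq₁ hqq
  have b1 := (h.boundary_le hX hρ hXa hXb hp₁ hxp₁).2
  have b2 := (h.boundary_le hX hρ hXa hXb hq₁ hxq₁).1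
  have e1 : |∫ s in a..p₁, 2 * X s * (ρ s * y' s)| ≤ 2 * (C * η) * K * |p₁ - a| := by
    rw [← Real.norm_eq_abs]
    apply intervalIntegral.norm_integral_le_of_norm_le_const_ae
    rw [uIoc_of_le hp₁.1.1.le]
    refine ae_Ioc_of_off_countable h.countable fun s hs => ?_
    have hs' : s ∈ Ioo a b := ⟨hs.1.1, hs.1.2.trans hp₁.1.2⟩
    rw [Real.norm_eq_abs, abs_mul, abs_mul, abs_two]
    have h1 := (h.abs_le_mul_sub hX hρ hXa hXb (Ioo_subset_Icc_self hs')).1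
    have h2 := hanti (Ioo_subset_Icc_self hs') (Ioo_subset_Icc_self hp₁.1) hs.1.2.le
    have h3 : C * (1 - x s) ≤ C * η := mul_le_mul_of_nonneg_left (by linarith) hC
    have h4 := hK s ⟨hs', hs.2⟩
    exact mul_le_mul (by linarith) h4 (abs_nonneg _) (by positivity)
  have e2 : |∫ s in q₁..b, 2 * X s * (ρ s * y' s)| ≤ 2 * (C * η) * K * |b - q₁| := by
    rw [← Real.norm_eq_abs]
    apply intervalIntegral.norm_integral_le_of_norm_le_const_ae
    rw [uIoc_of_le hq₁.1.2.le]
    refine ae_Ioc_of_off_countable h.countable fun s hs => ?_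
    have hs' : s ∈ Ioo a b := ⟨hq₁.1.1.trans hs.1.1, hs.1.2⟩
    rw [Real.norm_eq_abs, abs_mul, abs_mul, abs_two]
    have h1 := (h.abs_le_mul_sub hX hρ hXa hXb (Ioo_subset_Icc_self hs')).2
    have h2 := hanti (Ioo_subset_Icc_self hq₁.1) (Ioo_subset_Icc_self hs') hs.1.1.le
    have h3 : C * (1 + x s) ≤ C * η := mul_le_mul_of_nonneg_left (by linarith) hC
    have h4 := hK s ⟨hs', hs.2⟩
    exact mul_le_mul (by linarith) h4 (abs_nonneg _) (by positivity)
  have e1' : 2 * (C * η) * K * |p₁ - a| ≤ 2 * (C * η) * K * (b - a) := by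
    rw [abs_of_pos (sub_pos.2 hp₁.1.1)]
    exact mul_le_mul_of_nonneg_left (by linarith [hp₁.1.2]) (by positivity)
  have e2' : 2 * (C * η) * K * |b - q₁| ≤ 2 * (C * η) * K * (b - a) := by
    rw [abs_of_pos (sub_pos.2 hq₁.1.2)]
    exact mul_le_mul_of_nonneg_left (by linarith [hq₁.1.1]) (by positivity)
  have b1' : C ^ 2 * (1 - x p₁) * y p₁ ≤ C ^ 2 * η * B :=
    mul_le_mul (mul_le_mul_of_nonneg_left (by linarith) (sq_nonneg C))
      ((le_abs_self _).trans (hB p₁ (Ioo_subset_Icc_self hp₁.1))) (h.y_pos _ hp₁.1).le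
      (by positivity)
  have b2' : C ^ 2 * (1 + x q₁) * y q₁ ≤ C ^ 2 * η * B :=
    mul_le_mul (mul_le_mul_of_nonneg_left (by linarith) (sq_nonneg C))
      ((le_abs_self _).trans (hB q₁ (Ioo_subset_Icc_self hq₁.1))) (h.y_pos _ hq₁.1).le
      (by positivity)
  have i1 := hint a p₁ le_rfl hp₁.1.1.le hp₁.1.2.le
  have i2 := hint p₁ p hp₁.1.1.le hpp hp.1.2.le
  have i3 := hint p q hp.1.1.le hpq hq.1.2.le
  have i4 := hint q q₁ hq.1.1.le hqq hq₁.1.2.le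
  have i5 := hint q₁ b hq₁.1.1.le hq₁.1.2.le le_rfl
  have s1 := intervalIntegral.integral_add_adjacent_intervals i1 i2
  have s2 := intervalIntegral.integral_add_adjacent_intervals (i1.trans i2) i3
  have s3 := intervalIntegral.integral_add_adjacent_intervals ((i1.trans i2).trans i3) i4
  have s4 := intervalIntegral.integral_add_adjacent_intervals
    (((i1.trans i2).trans i3).trans i4) i5
  have hDη : D * η = 2 * (C ^ 2 * η * B) + 2 * (2 * (C * η) * K * (b - a)) := by
    rw [hD]; ring
  have a1 := (abs_le.1 e1).2
  have a2 := (abs_le.1 e2).2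
  linarith

/-- Wirtinger's inequality for a half curve. -/
theorem integral_nonpos (h : IsUpperHalf S a b x x' y y')
    (hX : IsPrimitive S a b X (fun s => ρ s * x' s))
    (hY : IsPrimitive S a b Y (fun s => ρ s * y' s)) (hρ : ∀ s ∈ Ioo a b \ S, |ρ s| ≤ C)
    (hXa : X a = 0) (hXb : X b = 0) : ∫ s in a..b, 2 * X s * (ρ s * y' s) ≤ 0 := by
  -- The degenerate interval `[p, p]`, of zero defect, is enough.
  obtain ⟨p, hp, hpx⟩ := h.exists_near (v := -1) (w := 1) le_rfl (by norm_num) le_rfl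
  have h1 := h.defect_nonneg hX hp hp (abs_lt.2 hpx) (abs_lt.2 hpx) le_rfl
  have h2 := h.defect_le hX hY hρ hXa hXb hp hp (abs_lt.2 hpx) (abs_lt.2 hpx) le_rfl
  linarith

/-- In the case of equality in Wirtinger's inequality, the half curve is straight near every
point where `X ≠ 0`. -/
theorem straight_of_integral_eq_zero (h : IsUpperHalf S a b x x' y y')
    (hX : IsPrimitive S a b X (fun s => ρ s * x' s))
    (hY : IsPrimitive S a b Y (fun s => ρ s * y' s)) (hρ : ∀ s ∈ Ioo a b \ S, |ρ s| ≤ C)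
    (hXa : X a = 0) (hXb : X b = 0) (h0 : ∫ s in a..b, 2 * X s * (ρ s * y' s) = 0) {s : ℝ}
    (hs : s ∈ Icc a b) (hXs : X s ≠ 0) :
    s ∈ Ioo a b ∧ |x s| < 1 ∧ ∃ δ > 0, ∀ p ∈ Ioo (s - δ) (s + δ) \ S,
      ∀ q ∈ Ioo (s - δ) (s + δ) \ S, x' p * y' q = y' p * x' q := by
  have hsI : s ∈ Ioo a b :=
    ⟨lt_of_le_of_ne hs.1 (by rintro rfl; exact hXs hXa),
      lt_of_le_of_ne hs.2 (by rintro rfl; exact hXs hXb)⟩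
  have hpos := abs_pos.2 hXs
  obtain ⟨c1, c2⟩ := h.abs_le_mul_sub hX hρ hXa hXb hs
  obtain ⟨hs1, hs2⟩ := abs_le.1 (h.abs_x_le s hs)
  have hxs : |x s| < 1 := by
    refine lt_of_le_of_ne (h.abs_x_le s hs) fun he => ?_
    rcases eq_or_eq_neg_of_abs_eq he with he | he <;> rw [he] at c1 c2 <;> linarith
  obtain ⟨hs3, hs4⟩ := abs_lt.1 hxs
  refine ⟨hsI, hxs, ?_⟩
  have hanti := h.antitoneOn
  obtain ⟨p, hp, hpx, hpx'⟩ := h.exists_near hs1 hs4 le_rfl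
  obtain ⟨q, hq, hqx, hqx'⟩ := h.exists_near le_rfl hs3 hs2
  have hps : p < s := by
    by_contra hn
    have := hanti hs (Ioo_subset_Icc_self hp.1) (not_lt.1 hn)
    linarith
  have hsq : s < q := by
    by_contra hn
    have := hanti (Ioo_subset_Icc_self hq.1) hs (not_lt.1 hn)
    linarith
  have hxp : |x p| < 1 := abs_lt.2 ⟨by linarith, hpx'⟩
  have hxq : |x q| < 1 := abs_lt.2 ⟨hqx, by linarith⟩
  have hpq := (hps.trans hsq).le
  obtain ⟨M, hM, hMeq⟩ := h.exists_monotone_slope hp hq hxp hxq hpq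
  -- The total defect is zero, so the defect over `[p, q]` is nonpositive and the slope is locally
  -- constant where `X² > 0`.
  have h1 := h.defect_le hX hY hρ hXa hXb hp hq hxp hxq hpq
  rw [h0, neg_zero, h.integral_eq_slope_integral hpq hMeq,
    ← (hMeq p ⟨left_mem_Icc.2 hpq, hp.2⟩).2.2, ← (hMeq q ⟨right_mem_Icc.2 hpq, hq.2⟩).2.2] at h1
  obtain ⟨δ, hδ, hconst⟩ := ((hX.mul hX).mono hp.1.1.le hq.1.2.le).eventuallyConst_of_stieltjes_eq_zero
    h.countable hM (fun s _ => mul_self_nonneg _) h1 ⟨hps, hsq⟩ (mul_self_pos.2 hXs)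
  refine ⟨min δ (min (s - p) (q - s)), lt_min hδ (lt_min (by linarith) (by linarith)), ?_⟩
  have m1 : min δ (min (s - p) (q - s)) ≤ δ := min_le_left _ _
  have m2 : min δ (min (s - p) (q - s)) ≤ s - p := (min_le_right _ _).trans (min_le_left _ _)
  have m3 : min δ (min (s - p) (q - s)) ≤ q - s := (min_le_right _ _).trans (min_le_right _ _)
  intro z hz w hw
  obtain ⟨hz1, hz2, hz3⟩ := hMeq z ⟨⟨by linarith [hz.1.1], by linarith [hz.1.2]⟩, hz.2⟩
  obtain ⟨hw1, hw2, hw3⟩ := hMeq w ⟨⟨by linarith [hw.1.1], by linarith [hw.1.2]⟩, hw.2⟩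
  have hz4 := (h.deriv_neg ⟨hz1, hz.2⟩ hz2).ne
  have hw4 := (h.deriv_neg ⟨hw1, hw.2⟩ hw2).ne
  have h2 := hconst z ⟨by linarith [hz.1.1], by linarith [hz.1.2]⟩
    w ⟨by linarith [hw.1.1], by linarith [hw.1.2]⟩
  rw [hz3, hw3, div_eq_div_iff hz4 hw4] at h2
  linarith

end IsUpperHalf

/-! ### Wirtinger's and Minkowski's inequalities on a convex loop -/

/-- A closed convex curve over `[0, L]`, made of an upper half over `[0, m]` and the opposite of an
upper half over `[m, L]`. -/
structure IsConvexLoop (S : Set ℝ) (m L : ℝ) (x x' y y' : ℝ → ℝ) : Prop where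
  upper : IsUpperHalf S 0 m x x' y y'
  lower : IsUpperHalf S m L (fun s => -x s) (fun s => -x' s) (fun s => -y s) (fun s => -y' s)
  hx : IsPrimitive S 0 L x x'
  hy : IsPrimitive S 0 L y y'
  det_pos : ∀ s ∈ Ioo 0 L \ S, 0 < x s * y' s - y s * x' s

theorem integral_pos_off_countable {S : Set ℝ} (hS : S.Countable) {a b : ℝ} (hab : a < b)
    {f : ℝ → ℝ} (hf : IntervalIntegrable f volume a b) (hpos : ∀ s ∈ Ioo a b \ S, 0 < f s) :
    0 < ∫ s in a..b, f s := by
  classical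
  have h1 : ∀ s ∈ Ioo a b \ S, f s = if s ∈ S then 1 else f s := fun s hs => by
    rw [if_neg hs.2]
  rw [integral_congr_off_countable hS hab.le h1]
  refine intervalIntegral.intervalIntegral_pos_of_pos_on
    (intervalIntegrable_congr_off_countable hS hab.le h1 hf) (fun s hs => ?_) hab
  by_cases hsS : s ∈ S
  · simp [hsS]
  · simpa [hsS] using hpos s ⟨hs, hsS⟩

namespace IsConvexLoop

variable {S : Set ℝ} {m L : ℝ} {x x' y y' : ℝ → ℝ}

theorem pos (h : IsConvexLoop S m L x x' y y') : 0 < L := h.upper.lt.trans h.lower.lt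

theorem integral_det_pos (h : IsConvexLoop S m L x x' y y') :
    0 < ∫ s in 0..L, (x s * y' s - y s * x' s) := by
  have hS := h.upper.countable
  exact integral_pos_off_countable hS h.pos
    ((h.hy.mul_intervalIntegrable hS h.pos.le h.hx.cont).sub
      (h.hx.mul_intervalIntegrable hS h.pos.le h.hy.cont)) h.det_pos

variable {X Y ρ : ℝ → ℝ} {C : ℝ}

/-- Wirtinger's inequality on a convex loop, with the case of equality. -/
theorem wirtinger (h : IsConvexLoop S m L x x' y y')
    (hX : IsPrimitive S 0 L X (fun s => ρ s * x' s))
    (hY : IsPrimitive S 0 L Y (fun s => ρ s * y' s)) (hρ : ∀ s ∈ Ioo 0 L \ S, |ρ s| ≤ C)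
    (hX0 : X 0 = 0) (hXm : X m = 0) (hXL : X L = 0) :
    ∫ s in 0..L, 2 * X s * (ρ s * y' s) ≤ 0 ∧
    (∫ s in 0..L, 2 * X s * (ρ s * y' s) = 0 → ∀ s ∈ Icc 0 L, X s ≠ 0 →
      s ∈ Ioo 0 L ∧ |x s| < 1 ∧ ∃ δ > 0, ∀ p ∈ Ioo (s - δ) (s + δ) \ S,
        ∀ q ∈ Ioo (s - δ) (s + δ) \ S, x' p * y' q = y' p * x' q) := by
  have hS := h.upper.countable
  have hm0 := h.upper.lt.le
  have hmL := h.lower.lt.le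
  have hX1 := hX.mono le_rfl hmL
  have hY1 := hY.mono le_rfl hmL
  -- On the lower half all coordinates change sign; `ρ` and the product `X Y'` are unaffected.
  have hX2 : IsPrimitive S m L (fun s => -X s) (fun s => ρ s * -x' s) :=
    (hX.mono hm0 le_rfl).neg.congr fun s _ => by ring
  have hY2 : IsPrimitive S m L (fun s => -Y s) (fun s => ρ s * -y' s) :=
    (hY.mono hm0 le_rfl).neg.congr fun s _ => by ring
  have hρ1 : ∀ s ∈ Ioo 0 m \ S, |ρ s| ≤ C := fun s hs => hρ s ⟨⟨hs.1.1, hs.1.2.trans_le hmL⟩, hs.2⟩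
  have hρ2 : ∀ s ∈ Ioo m L \ S, |ρ s| ≤ C := fun s hs => hρ s ⟨⟨hm0.trans_lt hs.1.1, hs.1.2⟩, hs.2⟩
  have i1 : IntervalIntegrable (fun s => 2 * X s * (ρ s * y' s)) volume 0 m :=
    hY1.mul_intervalIntegrable hS hm0 (hX1.cont.const_mul 2)
  have i2 : IntervalIntegrable (fun s => 2 * X s * (ρ s * y' s)) volume m L :=
    (hY.mono hm0 le_rfl).mul_intervalIntegrable hS hmL ((hX.mono hm0 le_rfl).cont.const_mul 2)
  have hsum := intervalIntegral.integral_add_adjacent_intervals i1 i2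
  have hXm' : -X m = 0 := by rw [hXm, neg_zero]
  have hXL' : -X L = 0 := by rw [hXL, neg_zero]
  have e2 : ∫ s in m..L, 2 * -X s * (ρ s * -y' s) = ∫ s in m..L, 2 * X s * (ρ s * y' s) := by
    congr 1
    ext s
    ring
  have n1 := h.upper.integral_nonpos hX1 hY1 hρ1 hX0 hXm
  have n2 := h.lower.integral_nonpos hX2 hY2 hρ2 hXm' hXL'
  rw [e2] at n2
  refine ⟨by linarith, fun h0 s hs hXs => ?_⟩
  rcases le_total s m with hsm | hsm
  · obtain ⟨a1, a2, a3⟩ := h.upper.straight_of_integral_eq_zero hX1 hY1 hρ1 hX0 hXm (by linarith)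
      ⟨hs.1, hsm⟩ hXs
    exact ⟨⟨a1.1, a1.2.trans_le hmL⟩, a2, a3⟩
  · obtain ⟨a1, a2, δ, hδ, a3⟩ := h.lower.straight_of_integral_eq_zero hX2 hY2 hρ2 hXm' hXL'
      (by rw [e2]; linarith) ⟨hsm, hs.2⟩ (neg_ne_zero.2 hXs)
    refine ⟨⟨hm0.trans_lt a1.1, a1.2⟩, by rwa [abs_neg] at a2, δ, hδ, fun p hp q hq => ?_⟩
    have := a3 p hp q hq
    linarith

variable {P Q r : ℝ → ℝ}

/-- Minkowski's inequality for a convex loop `(x, y)` and a closed curve `(P, Q)` with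
`(P, Q)' = r (x, y)'`. In the case of equality, the curve `(P - c x - p, Q - c y)` has vanishing
first coordinate wherever `(x, y)` is not straight. -/
theorem minkowski (h : IsConvexLoop S m L x x' y y')
    (hP : IsPrimitive S 0 L P (fun s => r s * x' s))
    (hQ : IsPrimitive S 0 L Q (fun s => r s * y' s)) (hr : ∀ s ∈ Ioo 0 L \ S, |r s| ≤ C)
    (hxc : x 0 = x L) (hyc : y 0 = y L) (hPc : P 0 = P L) (hQc : Q 0 = Q L) :
    (∫ s in 0..L, (P s * (r s * y' s) - Q s * (r s * x' s))) *
        (∫ s in 0..L, (x s * y' s - y s * x' s)) ≤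
      (∫ s in 0..L, (x s * (r s * y' s) - y s * (r s * x' s))) ^ 2 ∧
    ((∫ s in 0..L, (x s * (r s * y' s) - y s * (r s * x' s))) ^ 2 =
      (∫ s in 0..L, (P s * (r s * y' s) - Q s * (r s * x' s))) *
        (∫ s in 0..L, (x s * y' s - y s * x' s)) →
      ∃ c p : ℝ,
        ∫ s in 0..L, (x s * ((r s - c) * y' s) - y s * ((r s - c) * x' s)) = 0 ∧
        ∀ s ∈ Icc 0 L, P s - c * x s - p ≠ 0 → s ∈ Ioo 0 L ∧ |x s| < 1 ∧
          ∃ δ > 0, ∀ p ∈ Ioo (s - δ) (s + δ) \ S,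
            ∀ q ∈ Ioo (s - δ) (s + δ) \ S, x' p * y' q = y' p * x' q) := by
  have hS := h.upper.countable
  have hL := h.pos.le
  set A := ∫ s in 0..L, (P s * (r s * y' s) - Q s * (r s * x' s)) with hA
  set D := ∫ s in 0..L, (x s * y' s - y s * x' s) with hD
  set M := ∫ s in 0..L, (x s * (r s * y' s) - y s * (r s * x' s)) with hM
  -- Since `x 0 = 1` and `x m = -1`, these are the unique `c` and `p` for which `P - c x - p`
  -- vanishes at `0` and `m`.
  obtain ⟨c, hc⟩ : ∃ c, c = (P 0 - P m) / 2 := ⟨_, rfl⟩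
  obtain ⟨p, hp⟩ : ∃ p, p = (P 0 + P m) / 2 := ⟨_, rfl⟩
  have hx0 := h.upper.x_left
  have hxm := h.upper.x_right
  have hX : IsPrimitive S 0 L (fun s => P s - c * x s - p) (fun s => (r s - c) * x' s) := by
    have := ((hP.add (h.hx.const_mul (-c))).add_const (-p)).congr
      (g' := fun s => (r s - c) * x' s) fun s _ => by ring
    convert this using 2
    ring
  have hY : IsPrimitive S 0 L (fun s => Q s - c * y s) (fun s => (r s - c) * y' s) := by
    have := (hQ.add (h.hy.const_mul (-c))).congr
      (g' := fun s => (r s - c) * y' s) fun s _ => by ring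
    convert this using 2
    ring
  have hρ : ∀ s ∈ Ioo 0 L \ S, |r s - c| ≤ C + |c| := fun s hs =>
    (abs_sub _ _).trans (by linarith [hr s hs])
  have hX0 : P 0 - c * x 0 - p = 0 := by rw [hx0, hc, hp]; ring
  have hXm : P m - c * x m - p = 0 := by rw [hxm, hc, hp]; ring
  have hXL : P L - c * x L - p = 0 := by rw [← hPc, ← hxc]; exact hX0
  obtain ⟨w1, w2⟩ := h.wirtinger hX hY hρ hX0 hXm hXL
  have iA : IntervalIntegrable (fun s => P s * (r s * y' s) - Q s * (r s * x' s)) volume 0 L :=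
    (hQ.mul_intervalIntegrable hS hL hP.cont).sub (hP.mul_intervalIntegrable hS hL hQ.cont)
  have iD : IntervalIntegrable (fun s => x s * y' s - y s * x' s) volume 0 L :=
    (h.hy.mul_intervalIntegrable hS hL h.hx.cont).sub (h.hx.mul_intervalIntegrable hS hL h.hy.cont)
  have iM : IntervalIntegrable (fun s => x s * (r s * y' s) - y s * (r s * x' s)) volume 0 L :=
    (hQ.mul_intervalIntegrable hS hL h.hx.cont).sub (hP.mul_intervalIntegrable hS hL h.hy.cont)
  have iX : IntervalIntegrable (fun s => 2 * (P s - c * x s - p) * ((r s - c) * y' s)) volume 0 L :=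
    hY.mul_intervalIntegrable hS hL (hX.cont.const_mul 2)
  -- A primitive of the difference between `2 X Y'` and the integrand of `A - 2cM + c²D`; being
  -- built from closed curves, it has equal values at `0` and `L`.
  have hW := ((hX.mul hY).add ((((hP.mul h.hy).add (hQ.mul h.hx).neg).const_mul (-c)))).add
    (hY.const_mul (-p))
  have hWi := hW.integral_eq hS hL
  simp only [← hxc, ← hyc, ← hPc, ← hQc, sub_self] at hWi
  have hE : ∫ s in 0..L, 2 * (P s - c * x s - p) * ((r s - c) * y' s) =
      A - 2 * c * M + c ^ 2 * D := by
    have e1 : A - 2 * c * M + c ^ 2 * D = ∫ s in 0..L, (P s * (r s * y' s) - Q s * (r s * x' s) -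
        2 * c * (x s * (r s * y' s) - y s * (r s * x' s)) +
        c ^ 2 * (x s * y' s - y s * x' s)) := by
      rw [intervalIntegral.integral_add (iA.sub (iM.const_mul _)) (iD.const_mul _),
        intervalIntegral.integral_sub iA (iM.const_mul _), intervalIntegral.integral_const_mul,
        intervalIntegral.integral_const_mul]
    rw [e1, ← sub_eq_zero, ← intervalIntegral.integral_sub iX
      ((iA.sub (iM.const_mul _)).add (iD.const_mul _)), ← hWi]
    congr 1
    ext s
    ring
  rw [hE] at w1 w2
  have hDpos : 0 < D := h.integral_det_pos
  -- Completing the square: the first term on the right is nonpositive, so `M² ≥ A D`; when `M² = A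
  -- D`, both it and `c D - M` vanish.
  have hid : (c * D - M) ^ 2 = D * (A - 2 * c * M + c ^ 2 * D) + (M ^ 2 - A * D) := by ring
  refine ⟨?_, fun heq => ?_⟩
  · nlinarith [sq_nonneg (c * D - M), mul_nonneg hDpos.le (neg_nonneg.2 w1)]
  · have hE0 : A - 2 * c * M + c ^ 2 * D = 0 := by
      rw [heq, sub_self, add_zero] at hid
      refine le_antisymm w1 ?_
      exact nonneg_of_mul_nonneg_right (hid ▸ sq_nonneg (c * D - M)) hDpos
    have hcD : M - c * D = 0 := by
      rw [heq, sub_self, add_zero, hE0, mul_zero] at hid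
      have := pow_eq_zero_iff (two_ne_zero) |>.1 hid
      linarith
    refine ⟨c, p, ?_, w2 hE0⟩
    refine Eq.trans ?_ hcD
    rw [hM, hD, ← intervalIntegral.integral_const_mul,
      ← intervalIntegral.integral_sub iM (iD.const_mul c)]
    congr 1
    ext s
    ring

end IsConvexLoop

/-! ### Partitions and piecewise smooth curves -/

/-- `t 0 < t 1 < ... < t m`. -/
def IsPartition (m : ℕ) (t : ℕ → ℝ) : Prop := ∀ i < m, t i < t (i + 1)

namespace IsPartition

variable {m : ℕ} {t : ℕ → ℝ}

theorem mono (h : IsPartition m t) {i j : ℕ} (hij : i ≤ j) (hj : j ≤ m) : t i ≤ t j := by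
  induction j, hij using Nat.le_induction with
  | base => rfl
  | succ k hk ih => exact (ih (by omega)).trans (h k (by omega)).le

theorem Icc_subset (h : IsPartition m t) {i : ℕ} (hi : i < m) :
    Icc (t i) (t (i + 1)) ⊆ Icc (t 0) (t m) :=
  Icc_subset_Icc (h.mono (Nat.zero_le i) hi.le) (h.mono (Nat.succ_le_of_lt hi) le_rfl)

theorem Ioo_subset (h : IsPartition m t) {i : ℕ} (hi : i < m) :
    Ioo (t i) (t (i + 1)) ⊆ Ioo (t 0) (t m) \ t '' Iic m := by
  refine fun s hs => ⟨Ioo_subset_Ioo (h.mono (Nat.zero_le i) hi.le)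
    (h.mono (Nat.succ_le_of_lt hi) le_rfl) hs, ?_⟩
  rintro ⟨j, hj, rfl⟩
  rcases le_or_gt j i with hji | hji
  · exact hs.1.not_ge (h.mono hji hi.le)
  · exact hs.2.not_ge (h.mono (Nat.succ_le_of_lt hji) hj)

theorem exists_mem_Icc (h : IsPartition m t) (hm : 0 < m) {s : ℝ} (hs : s ∈ Icc (t 0) (t m)) :
    ∃ i < m, s ∈ Icc (t i) (t (i + 1)) := by
  induction m with
  | zero => omega
  | succ k ih =>
    rcases le_total (t k) s with hk | hk
    · exact ⟨k, by omega, hk, hs.2⟩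
    · rcases Nat.eq_zero_or_pos k with rfl | hk0
      · exact ⟨0, by omega, hs⟩
      · obtain ⟨i, hi, his⟩ := ih (fun i hi => h i (by omega)) hk0 ⟨hs.1, hk⟩
        exact ⟨i, by omega, his⟩

theorem pos_of_mem_Ioo (_h : IsPartition m t) {s : ℝ} (hs : s ∈ Ioo (t 0) (t m)) : 0 < m := by
  rcases Nat.eq_zero_or_pos m with rfl | hm
  · exact absurd (hs.1.trans hs.2) (lt_irrefl _)
  · exact hm

theorem exists_mem_Ioo (h : IsPartition m t) {s : ℝ} (hs : s ∈ Ioo (t 0) (t m) \ t '' Iic m) :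
    ∃ i < m, s ∈ Ioo (t i) (t (i + 1)) := by
  obtain ⟨i, hi, his⟩ := h.exists_mem_Icc (h.pos_of_mem_Ioo hs.1) (Ioo_subset_Icc_self hs.1)
  refine ⟨i, hi, lt_of_le_of_ne his.1 ?_, lt_of_le_of_ne his.2 ?_⟩
  · rintro rfl
    exact hs.2 ⟨i, hi.le, rfl⟩
  · rintro rfl
    exact hs.2 ⟨i + 1, Nat.succ_le_of_lt hi, rfl⟩

theorem countable (m : ℕ) (t : ℕ → ℝ) : (t '' Iic m).Countable := (to_countable _).image _

end IsPartition

/-- A curve that is smooth on every closed arc of a partition. -/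
structure IsPiecewiseSmooth (m : ℕ) (t : ℕ → ℝ) (f : ℝ → ℝ × ℝ) : Prop where
  partition : IsPartition m t
  smooth : ∀ i < m, ContDiffOn ℝ ∞ f (Icc (t i) (t (i + 1)))

namespace IsPiecewiseSmooth

variable {m : ℕ} {t : ℕ → ℝ} {f : ℝ → ℝ × ℝ}

theorem derivWithin_eq {a b s : ℝ} (hs : s ∈ Ioo a b) : derivWithin f (Icc a b) s = deriv f s :=
  derivWithin_of_mem_nhds (Icc_mem_nhds hs.1 hs.2)

theorem uniqueDiffOn (h : IsPiecewiseSmooth m t f) {i : ℕ} (hi : i < m) :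
    UniqueDiffOn ℝ (Icc (t i) (t (i + 1))) := uniqueDiffOn_Icc (h.partition i hi)

theorem hasDerivAt (h : IsPiecewiseSmooth m t f) {i : ℕ} (hi : i < m) {s : ℝ}
    (hs : s ∈ Ioo (t i) (t (i + 1))) : HasDerivAt f (deriv f s) s :=
  (((h.smooth i hi).contDiffAt (Icc_mem_nhds hs.1 hs.2)).differentiableAt (by simp)).hasDerivAt

theorem continuousOn_derivWithin (h : IsPiecewiseSmooth m t f) {i : ℕ} (hi : i < m) :
    ContinuousOn (derivWithin f (Icc (t i) (t (i + 1)))) (Icc (t i) (t (i + 1))) :=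
  (h.smooth i hi).continuousOn_derivWithin (h.uniqueDiffOn hi) (by simp)

theorem hasDerivWithinAt (h : IsPiecewiseSmooth m t f) {i : ℕ} (hi : i < m) {s : ℝ}
    (hs : s ∈ Icc (t i) (t (i + 1))) :
    HasDerivWithinAt f (derivWithin f (Icc (t i) (t (i + 1))) s) (Icc (t i) (t (i + 1))) s :=
  ((h.smooth i hi).differentiableOn (by simp) s hs).hasDerivWithinAt

theorem hasDerivAt_deriv (h : IsPiecewiseSmooth m t f) {i : ℕ} (hi : i < m) {s : ℝ}
    (hs : s ∈ Ioo (t i) (t (i + 1))) :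
    HasDerivAt (deriv f) (derivWithin (derivWithin f (Icc (t i) (t (i + 1))))
      (Icc (t i) (t (i + 1))) s) s := by
  have h1 : ContDiffOn ℝ ∞ (derivWithin f (Icc (t i) (t (i + 1)))) (Icc (t i) (t (i + 1))) :=
    (h.smooth i hi).derivWithin (h.uniqueDiffOn hi) (by simp)
  have h2 : HasDerivAt (derivWithin f (Icc (t i) (t (i + 1)))) _ s :=
    ((h1.differentiableOn (by simp) s (Ioo_subset_Icc_self hs)).hasDerivWithinAt).hasDerivAt
      (Icc_mem_nhds hs.1 hs.2)
  refine h2.congr_of_eventuallyEq ?_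
  filter_upwards [Ioo_mem_nhds hs.1 hs.2] with z hz using (derivWithin_eq hz).symm

theorem continuousOn (h : IsPiecewiseSmooth m t f) : ContinuousOn f (Icc (t 0) (t m)) := by
  have key : ∀ k ≤ m, ContinuousOn f (Icc (t 0) (t k)) := by
    intro k
    induction k with
    | zero => intro _; simp
    | succ k ih =>
      intro hk
      rw [← Icc_union_Icc_eq_Icc (h.partition.mono (Nat.zero_le k) (by omega))
        (h.partition k (by omega)).le]
      exact (ih (by omega)).union_of_isClosed (h.smooth k (by omega)).continuousOn
        isClosed_Icc isClosed_Icc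
  exact key m le_rfl

theorem exists_bound (h : IsPiecewiseSmooth m t f) :
    ∃ K, ∀ i < m, ∀ s ∈ Ioo (t i) (t (i + 1)), ‖deriv f s‖ ≤ K := by
  have h1 : ∀ i, ∃ K, i < m → ∀ s ∈ Icc (t i) (t (i + 1)),
      ‖derivWithin f (Icc (t i) (t (i + 1))) s‖ ≤ K := fun i => by
    by_cases hi : i < m
    · obtain ⟨K, hK⟩ := isCompact_Icc.exists_bound_of_continuousOn (h.continuousOn_derivWithin hi)
      exact ⟨K, fun _ => hK⟩
    · exact ⟨0, fun h => absurd h hi⟩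
  choose K hK using h1
  obtain ⟨B, hB⟩ := ((Finset.range m).image K).exists_le
  refine ⟨B, fun i hi s hs => ?_⟩
  rw [← derivWithin_eq hs]
  exact (hK i hi s (Ioo_subset_Icc_self hs)).trans
    (hB _ (Finset.mem_image_of_mem _ (Finset.mem_range.2 hi)))

/-- Continuity of the one-sided derivatives on compact arcs keeps the speed away from zero. This
bounds the curvature radius, up to sign a quotient of two speeds. -/
theorem exists_lower_bound (h : IsPiecewiseSmooth m t f)
    (h0 : ∀ i < m, ∀ s ∈ Icc (t i) (t (i + 1)), derivWithin f (Icc (t i) (t (i + 1))) s ≠ 0) :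
    ∃ K, ∀ i < m, ∀ s ∈ Ioo (t i) (t (i + 1)), ‖deriv f s‖⁻¹ ≤ K := by
  have h1 : ∀ i, ∃ K, i < m → ∀ s ∈ Icc (t i) (t (i + 1)),
      ‖‖derivWithin f (Icc (t i) (t (i + 1))) s‖⁻¹‖ ≤ K := fun i => by
    by_cases hi : i < m
    · obtain ⟨K, hK⟩ := isCompact_Icc.exists_bound_of_continuousOn
        ((h.continuousOn_derivWithin hi).norm.inv₀ fun s hs => norm_ne_zero_iff.2 (h0 i hi s hs))
      exact ⟨K, fun _ => hK⟩
    · exact ⟨0, fun h => absurd h hi⟩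
  choose K hK using h1
  obtain ⟨B, hB⟩ := ((Finset.range m).image K).exists_le
  refine ⟨B, fun i hi s hs => ?_⟩
  rw [← derivWithin_eq hs]
  exact (le_abs_self _).trans ((hK i hi s (Ioo_subset_Icc_self hs)).trans
    (hB _ (Finset.mem_image_of_mem _ (Finset.mem_range.2 hi))))

theorem isPrimitive (h : IsPiecewiseSmooth m t f) (l : ℝ × ℝ →L[ℝ] ℝ) :
    IsPrimitive (t '' Iic m) (t 0) (t m) (fun s => l (f s)) (fun s => l (deriv f s)) where
  cont := l.continuous.comp_continuousOn h.continuousOn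
  deriv s hs := by
    obtain ⟨i, hi, his⟩ := h.partition.exists_mem_Ioo hs
    exact l.hasFDerivAt.comp_hasDerivAt s (h.hasDerivAt hi his)
  bdd := by
    obtain ⟨K, hK⟩ := h.exists_bound
    refine ⟨‖l‖ * K, fun s hs => ?_⟩
    obtain ⟨i, hi, his⟩ := h.partition.exists_mem_Ioo hs
    exact (l.le_opNorm _).trans (mul_le_mul_of_nonneg_left (hK i hi s his) (norm_nonneg _))

end IsPiecewiseSmooth

/-! ### Determinants and coordinates in a basis -/

/-- The linear form `[·, d]`. -/
noncomputable def detRight (d : ℝ × ℝ) : ℝ × ℝ →L[ℝ] ℝ :=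
  d.2 • ContinuousLinearMap.fst ℝ ℝ ℝ - d.1 • ContinuousLinearMap.snd ℝ ℝ ℝ

/-- The linear form `[a, ·]`. -/
noncomputable def detLeft (a : ℝ × ℝ) : ℝ × ℝ →L[ℝ] ℝ :=
  a.1 • ContinuousLinearMap.snd ℝ ℝ ℝ - a.2 • ContinuousLinearMap.fst ℝ ℝ ℝ

theorem detRight_apply (d w : ℝ × ℝ) : detRight d w = det w d := by
  simp [detRight, det]; ring

theorem detLeft_apply (a w : ℝ × ℝ) : detLeft a w = det a w := by
  simp [detLeft, det]

/-- The first coordinate with respect to the basis `a`, `d`. -/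
noncomputable def coordX (a d : ℝ × ℝ) : ℝ × ℝ →L[ℝ] ℝ := (det a d)⁻¹ • detRight d

/-- The second coordinate with respect to the basis `a`, `d`. -/
noncomputable def coordY (a d : ℝ × ℝ) : ℝ × ℝ →L[ℝ] ℝ := (det a d)⁻¹ • detLeft a

theorem coordX_apply (a d w : ℝ × ℝ) : coordX a d w = det w d / det a d := by
  simp [coordX, detRight_apply, div_eq_inv_mul]

theorem coordY_apply (a d w : ℝ × ℝ) : coordY a d w = det a w / det a d := by
  simp [coordY, detLeft_apply, div_eq_inv_mul]

theorem coord_decomp {a d : ℝ × ℝ} (h : det a d ≠ 0) (w : ℝ × ℝ) :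
    w = coordX a d w • a + coordY a d w • d := by
  rw [coordX_apply, coordY_apply]
  have h' := h
  ext
  · simp only [Prod.fst_add, Prod.smul_fst, smul_eq_mul]
    field_simp
    simp only [det]
    ring
  · simp only [Prod.snd_add, Prod.smul_snd, smul_eq_mul]
    field_simp
    simp only [det]
    ring

theorem det_eq_coord {a d : ℝ × ℝ} (h : det a d ≠ 0) (w z : ℝ × ℝ) :
    det w z = det a d * (coordX a d w * coordY a d z - coordY a d w * coordX a d z) := by
  simp only [coordX_apply, coordY_apply]
  field_simp
  simp only [det]
  ring

/-! ### Supporting lines and orientation of the unit circle -/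

/-- The tangent line of the unit circle of a norm is a supporting line of the unit ball. -/
theorem abs_det_le_of_hasDerivAt {N : Seminorm ℝ (ℝ × ℝ)} {u : ℝ → ℝ × ℝ} {s : ℝ} {v : ℝ × ℝ}
    (hu : ∀ᶠ σ in 𝓝 s, N (u σ) = 1) (hv : HasDerivAt u v s) {z : ℝ × ℝ}
    (hz : N z ≤ 1) : |det z v| ≤ |det (u s) v| := by
  have hus : N (u s) = 1 := hu.self_of_nhds
  have hus0 : u s ≠ 0 := by
    intro h
    rw [h, map_zero] at hus
    exact zero_ne_one hus
  -- Hahn-Banach: a linear form `g ≤ N` with `g (u s) = 1`. Along `u` it is maximal at `s`, so `g v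
  -- = 0`, and in the plane this makes `[·, v]` the multiple `[u s, v] g` of `g`.
  obtain ⟨g, hg1, hg2⟩ := exists_extension_of_le_sublinear
    (LinearPMap.mkSpanSingleton (σ := RingHom.id ℝ) (u s) (1 : ℝ) hus0) N
    (fun c hc x => by rw [map_smul_eq_mul, Real.norm_of_nonneg hc.le]) (fun x y => map_add_le_add N x y)
    (by
      rintro ⟨x, hx⟩
      obtain ⟨c, rfl⟩ := Submodule.mem_span_singleton.1 hx
      have h1 := LinearPMap.mkSpanSingleton'_apply (σ := RingHom.id ℝ) (u s) (1 : ℝ)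
        (fun c hc => by
          rcases smul_eq_zero.1 hc with h | h
          · simp [h]
          · exact absurd h hus0) c hx
      have h2 : N (c • u s) = |c| := by rw [map_smul_eq_mul, hus, mul_one, Real.norm_eq_abs]
      refine le_trans (le_of_eq h1) ?_
      simp only [RingHom.id_apply, smul_eq_mul, mul_one]
      rw [h2]
      exact le_abs_self c)
  have hgu : g (u s) = 1 := by
    have h1 := hg1 ⟨u s, Submodule.mem_span_singleton_self _⟩
    rw [LinearPMap.mkSpanSingleton_apply] at h1
    exact h1
  have hgv : g v = 0 := by
    have hder : HasDerivAt (fun σ => g (u σ)) (g v) s :=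
      (LinearMap.toContinuousLinearMap g).hasFDerivAt.comp_hasDerivAt s hv
    refine IsLocalMax.hasDerivAt_eq_zero ?_ hder
    filter_upwards [hu] with σ hσ
    rw [hgu, ← hσ]
    exact hg2 _
  have hgz : |g z| ≤ 1 := by
    rw [abs_le]
    have h1 := hg2 z
    have h2 := hg2 (-z)
    rw [map_neg, map_neg_eq_map] at h2
    constructor <;> linarith
  have hid : det z v = g z * det (u s) v := by
    have h1 : det z v • u s = det (u s) v • z + det z (u s) • v := by
      ext <;> simp [det] <;> ring
    have h2 := congrArg g h1
    rw [map_add, map_smul, map_smul, map_smul, hgu, hgv] at h2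
    simp only [smul_eq_mul, mul_one, mul_zero, add_zero] at h2
    rw [h2, mul_comm]
  rw [hid, abs_mul]
  exact mul_le_of_le_one_left (abs_nonneg _) hgz

namespace IsUnitCircle

variable {N : Seminorm ℝ (ℝ × ℝ)} {T : ℝ} {n : ℕ} {t : ℕ → ℝ} {u : ℝ → ℝ × ℝ}

theorem piecewiseSmooth (hu : IsUnitCircle N T n t u) : IsPiecewiseSmooth (2 * n) t u :=
  ⟨hu.t_lt, hu.smooth⟩

theorem partition (hu : IsUnitCircle N T n t u) : IsPartition (2 * n) t := hu.t_lt

theorem n_pos (hu : IsUnitCircle N T n t u) : 0 < n := by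
  rcases Nat.eq_zero_or_pos n with rfl | h
  · have h1 := hu.t_last
    rw [mul_zero, hu.t_zero] at h1
    linarith [hu.T_pos]
  · exact h

theorem continuousOn (hu : IsUnitCircle N T n t u) : ContinuousOn u (Icc 0 (2 * T)) := by
  have := hu.piecewiseSmooth.continuousOn
  rwa [hu.t_zero, hu.t_last] at this

theorem norm_eq (hu : IsUnitCircle N T n t u) {s : ℝ} (hs : s ∈ Icc 0 (2 * T)) : N (u s) = 1 := by
  have : u s ∈ {x | N x = 1} := by
    rw [← hu.image_eq]
    exact mem_image_of_mem u hs
  exact this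

theorem Icc_subset (hu : IsUnitCircle N T n t u) {i : ℕ} (hi : i < 2 * n) :
    Icc (t i) (t (i + 1)) ⊆ Icc 0 (2 * T) := by
  have := hu.partition.Icc_subset hi
  rwa [hu.t_zero, hu.t_last] at this

theorem Ioo_subset (hu : IsUnitCircle N T n t u) {i : ℕ} (hi : i < 2 * n) :
    Ioo (t i) (t (i + 1)) ⊆ Ioo 0 (2 * T) \ t '' Iic (2 * n) := by
  have := hu.partition.Ioo_subset hi
  rwa [hu.t_zero, hu.t_last] at this

theorem exists_mem_Ioo (hu : IsUnitCircle N T n t u) {s : ℝ}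
    (hs : s ∈ Ioo 0 (2 * T) \ t '' Iic (2 * n)) : ∃ i < 2 * n, s ∈ Ioo (t i) (t (i + 1)) :=
  hu.partition.exists_mem_Ioo (by rwa [hu.t_zero, hu.t_last])

theorem exists_mem_Icc (hu : IsUnitCircle N T n t u) {s : ℝ} (hs : s ∈ Icc 0 (2 * T)) :
    ∃ i < 2 * n, s ∈ Icc (t i) (t (i + 1)) :=
  hu.partition.exists_mem_Icc (by have := hu.n_pos; omega) (by rwa [hu.t_zero, hu.t_last])

/-- The inequality passes from the open arc to its endpoints by continuity of the one-sided
derivative. The endpoint `0` matters, because the coordinates are based there. -/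
theorem abs_det_le (hu : IsUnitCircle N T n t u) {i : ℕ} (hi : i < 2 * n) {s : ℝ}
    (hs : s ∈ Icc (t i) (t (i + 1))) {z : ℝ × ℝ} (hz : N z ≤ 1) :
    |det z (derivWithin u (Icc (t i) (t (i + 1))) s)| ≤
      |det (u s) (derivWithin u (Icc (t i) (t (i + 1))) s)| := by
  have hsm := hu.piecewiseSmooth
  have hv := hsm.continuousOn_derivWithin hi
  have huc := (hu.smooth i hi).continuousOn
  have hclosed := isClosed_Icc.isClosed_le
    (f := fun s => |det z (derivWithin u (Icc (t i) (t (i + 1))) s)|)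
    (g := fun s => |det (u s) (derivWithin u (Icc (t i) (t (i + 1))) s)|)
    (s := Icc (t i) (t (i + 1))) (by unfold det; fun_prop) (by unfold det; fun_prop)
  have hsub : Ioo (t i) (t (i + 1)) ⊆ {s | s ∈ Icc (t i) (t (i + 1)) ∧
      |det z (derivWithin u (Icc (t i) (t (i + 1))) s)| ≤
        |det (u s) (derivWithin u (Icc (t i) (t (i + 1))) s)|} := by
    refine fun σ hσ => ⟨Ioo_subset_Icc_self hσ, ?_⟩
    rw [IsPiecewiseSmooth.derivWithin_eq hσ]
    refine abs_det_le_of_hasDerivAt ?_ (hsm.hasDerivAt hi hσ) hz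
    filter_upwards [Ioo_mem_nhds hσ.1 hσ.2] with σ' hσ' using
      hu.norm_eq (hu.Icc_subset hi (Ioo_subset_Icc_self hσ'))
  have := closure_minimal hsub hclosed
  rw [closure_Ioo (hu.t_lt i hi).ne] at this
  exact (this hs).2

/-- Otherwise the support inequality would give `[z, v] = 0` on the whole unit ball, which contains
a positive multiple of the rotated vector `(v.2, -v.1)`. -/
theorem det_ne_zero (hu : IsUnitCircle N T n t u) {i : ℕ} (hi : i < 2 * n) {s : ℝ}
    (hs : s ∈ Icc (t i) (t (i + 1))) :
    det (u s) (derivWithin u (Icc (t i) (t (i + 1))) s) ≠ 0 := by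
  intro h0
  set v := derivWithin u (Icc (t i) (t (i + 1))) s with hv
  have hv0 : v ≠ 0 := hu.deriv_ne_zero i hi s hs
  have hN : 0 < N (v.2, -v.1) + 1 := by have := apply_nonneg N (v.2, -v.1); linarith
  have h1 := hu.abs_det_le hi hs (z := (N (v.2, -v.1) + 1)⁻¹ • (v.2, -v.1)) (by
    rw [map_smul_eq_mul, Real.norm_of_nonneg (inv_nonneg.2 hN.le), inv_mul_le_iff₀ hN]
    linarith)
  rw [← hv, h0, abs_zero, abs_nonpos_iff] at h1
  have h2 : (N (v.2, -v.1) + 1)⁻¹ * (v.2 * v.2 + v.1 * v.1) = 0 := by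
    rw [← h1]
    simp [det]
    ring
  rcases mul_eq_zero.1 h2 with h3 | h3
  · exact (inv_ne_zero hN.ne') h3
  · refine hv0 (Prod.ext ?_ ?_) <;> simp only [Prod.fst_zero, Prod.snd_zero] <;> nlinarith [sq_nonneg v.1, sq_nonneg v.2]

theorem det_mul_pos_arc (hu : IsUnitCircle N T n t u) {i : ℕ} (hi : i < 2 * n) {s σ : ℝ}
    (hs : s ∈ Icc (t i) (t (i + 1))) (hσ : σ ∈ Icc (t i) (t (i + 1))) :
    0 < det (u s) (derivWithin u (Icc (t i) (t (i + 1))) s) *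
      det (u σ) (derivWithin u (Icc (t i) (t (i + 1))) σ) := by
  have hv := hu.piecewiseSmooth.continuousOn_derivWithin hi
  have huc := (hu.smooth i hi).continuousOn
  have hc : ContinuousOn (fun s => det (u s) (derivWithin u (Icc (t i) (t (i + 1))) s))
      (Icc (t i) (t (i + 1))) := by unfold det; fun_prop
  have hsub : uIcc s σ ⊆ Icc (t i) (t (i + 1)) := uIcc_subset_Icc hs hσ
  by_contra hneg
  have h0 : (0 : ℝ) ∈ uIcc (det (u s) (derivWithin u (Icc (t i) (t (i + 1))) s))
      (det (u σ) (derivWithin u (Icc (t i) (t (i + 1))) σ)) := by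
    rw [mem_uIcc]
    rcases mul_nonpos_iff.1 (not_lt.1 hneg) with h | h
    · exact Or.inr ⟨h.2, h.1⟩
    · exact Or.inl h
  obtain ⟨p, hp, hp0⟩ := intermediate_value_uIcc (hc.mono hsub) h0
  exact hu.det_ne_zero hi (hsub hp) hp0

theorem eq_of_smul_eq (hu : IsUnitCircle N T n t u) {p q : ℝ} (hp : p ∈ Ico 0 (2 * T))
    (hq : q ∈ Ico 0 (2 * T)) {k : ℝ} (hk : 0 < k) (h : u p = k • u q) : p = q := by
  have h1 := hu.norm_eq (Ico_subset_Icc_self hp)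
  have h2 := hu.norm_eq (Ico_subset_Icc_self hq)
  rw [h, map_smul_eq_mul, h2, mul_one, Real.norm_of_nonneg hk.le] at h1
  rw [h1, one_smul] at h
  exact hu.injOn hp hq h

/-- The curve `u` keeps its orientation at every vertex. -/
theorem det_mul_pos_vertex (hu : IsUnitCircle N T n t u) {i : ℕ} (hi : i + 1 < 2 * n) :
    ∃ p ∈ Icc (t i) (t (i + 1)), ∃ q ∈ Icc (t (i + 1)) (t (i + 1 + 1)),
      0 < det (u p) (derivWithin u (Icc (t i) (t (i + 1))) p) *
        det (u q) (derivWithin u (Icc (t (i + 1)) (t (i + 1 + 1))) q) := by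
  have hi' : i < 2 * n := by omega
  set τ := t (i + 1) with hτ
  have l1 : t i < τ := hu.t_lt i hi'
  have l2 : τ < t (i + 1 + 1) := hu.t_lt (i + 1) hi
  have hτm : τ ∈ Ioo 0 (2 * T) :=
    ⟨(hu.Icc_subset hi' (left_mem_Icc.2 l1.le)).1.trans_lt l1,
      l2.trans_le (hu.Icc_subset hi (right_mem_Icc.2 l2.le)).2⟩
  set a := u τ with ha
  have ha0 : 0 < a.1 * a.1 + a.2 * a.2 := by
    by_contra hneg
    have h1 : a.1 = 0 := by nlinarith [sq_nonneg a.1, sq_nonneg a.2]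
    have h2 : a.2 = 0 := by nlinarith [sq_nonneg a.1, sq_nonneg a.2]
    have h3 := hu.norm_eq (Ioo_subset_Icc_self hτm)
    rw [← ha, show a = 0 from Prod.ext h1 h2, map_zero] at h3
    exact zero_ne_one h3
  -- Up to the factor `|a|`, `f` and `g` are the components of `u` along `a` and across it, so `g /
  -- f` is the tangent of the angle from `a`. It is injective near `τ` because `u` meets each ray at
  -- most once.
  set f : ℝ → ℝ := fun s => a.1 * (u s).1 + a.2 * (u s).2 with hf
  set g : ℝ → ℝ := fun s => a.1 * (u s).2 - a.2 * (u s).1 with hg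
  have hucont := hu.continuousOn
  have hfc : ContinuousOn f (Icc 0 (2 * T)) := by fun_prop
  have hgc : ContinuousOn g (Icc 0 (2 * T)) := by fun_prop
  have hev : ∀ᶠ s in 𝓝 τ, 0 < f s ∧ s ∈ Ioo (t i) (t (i + 1 + 1)) :=
    Filter.Eventually.and
      ((hfc.continuousAt (Icc_mem_nhds hτm.1 hτm.2)).eventually (lt_mem_nhds ha0))
      (Ioo_mem_nhds l1 l2)
  obtain ⟨ε, hε, hball⟩ := Metric.eventually_nhds_iff.1 hev
  have hin : ∀ s ∈ Icc (τ - ε / 2) (τ + ε / 2), 0 < f s ∧ s ∈ Ioo (t i) (t (i + 1 + 1)) :=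
    fun s hs => hball (by rw [Real.dist_eq, abs_lt]; constructor <;> linarith [hs.1, hs.2])
  have hsub : Icc (τ - ε / 2) (τ + ε / 2) ⊆ Ico 0 (2 * T) := fun s hs =>
    ⟨(hu.Icc_subset hi' (left_mem_Icc.2 l1.le)).1.trans (hin s hs).2.1.le,
      (hin s hs).2.2.trans_le (hu.Icc_subset hi (right_mem_Icc.2 l2.le)).2⟩
  have hφc : ContinuousOn (g / f) (Icc (τ - ε / 2) (τ + ε / 2)) :=
    (hgc.mono (hsub.trans Ico_subset_Icc_self)).div (hfc.mono (hsub.trans Ico_subset_Icc_self))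
      fun s hs => (hin s hs).1.ne'
  have hφi : InjOn (g / f) (Icc (τ - ε / 2) (τ + ε / 2)) := by
    intro p hp q hq hpq
    have fp := (hin p hp).1
    have fq := (hin q hq).1
    simp only [Pi.div_apply] at hpq
    rw [div_eq_div_iff fp.ne' fq.ne'] at hpq
    refine hu.eq_of_smul_eq (hsub hp) (hsub hq) (div_pos fp fq) ?_
    have e1 : (a.1 * a.1 + a.2 * a.2) * ((u p).1 * f q - f p * (u q).1) = 0 := by
      have : (a.1 * a.1 + a.2 * a.2) * ((u p).1 * f q - f p * (u q).1) =
        -(a.2 * (g p * f q - g q * f p)) := by simp only [hf, hg]; ring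
      rw [this, hpq]; ring
    have e2 : (a.1 * a.1 + a.2 * a.2) * ((u p).2 * f q - f p * (u q).2) = 0 := by
      have : (a.1 * a.1 + a.2 * a.2) * ((u p).2 * f q - f p * (u q).2) =
        a.1 * (g p * f q - g q * f p) := by simp only [hf, hg]; ring
      rw [this, hpq]; ring
    have e1' := (mul_eq_zero.1 e1).resolve_left ha0.ne'
    have e2' := (mul_eq_zero.1 e2).resolve_left ha0.ne'
    ext
    · simp only [Prod.smul_fst, smul_eq_mul]
      rw [div_mul_eq_mul_div, eq_div_iff fq.ne']
      linarith
    · simp only [Prod.smul_snd, smul_eq_mul]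
      rw [div_mul_eq_mul_div, eq_div_iff fq.ne']
      linarith
  have hder : ∀ j < 2 * n, ∀ s ∈ Ioo (t j) (t (j + 1)), s ∈ Ioo (τ - ε / 2) (τ + ε / 2) →
      derivWithin (g / f) (Icc (τ - ε / 2) (τ + ε / 2)) s =
        (a.1 * a.1 + a.2 * a.2) * det (u s) (derivWithin u (Icc (t j) (t (j + 1))) s) / f s ^ 2 := by
    intro j hj s hs hsε
    have hd := hu.piecewiseSmooth.hasDerivAt hj hs
    have d1 : HasDerivAt (fun s => (u s).1) (deriv u s).1 s :=
      (ContinuousLinearMap.fst ℝ ℝ ℝ).hasFDerivAt.comp_hasDerivAt s hd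
    have d2 : HasDerivAt (fun s => (u s).2) (deriv u s).2 s :=
      (ContinuousLinearMap.snd ℝ ℝ ℝ).hasFDerivAt.comp_hasDerivAt s hd
    have df : HasDerivAt f (a.1 * (deriv u s).1 + a.2 * (deriv u s).2) s :=
      (d1.const_mul a.1).add (d2.const_mul a.2)
    have dg : HasDerivAt g (a.1 * (deriv u s).2 - a.2 * (deriv u s).1) s :=
      (d2.const_mul a.1).sub (d1.const_mul a.2)
    rw [derivWithin_of_mem_nhds (Icc_mem_nhds hsε.1 hsε.2),
      (dg.div df (hin s (Ioo_subset_Icc_self hsε)).1.ne').deriv,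
      IsPiecewiseSmooth.derivWithin_eq hs]
    congr 1
    simp only [hf, hg, det]
    ring
  obtain ⟨p, hp⟩ := nonempty_Ioo.2 (max_lt l1 (by linarith : τ - ε / 2 < τ))
  obtain ⟨q, hq⟩ := nonempty_Ioo.2 (lt_min l2 (by linarith : τ < τ + ε / 2))
  have hp1 : p ∈ Ioo (t i) (t (i + 1)) := ⟨(le_max_left _ _).trans_lt hp.1, hp.2⟩
  have hp2 : p ∈ Ioo (τ - ε / 2) (τ + ε / 2) := ⟨(le_max_right _ _).trans_lt hp.1, by linarith [hp.2]⟩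
  have hq1 : q ∈ Ioo (t (i + 1)) (t (i + 1 + 1)) := ⟨hq.1, hq.2.trans_le (min_le_left _ _)⟩
  have hq2 : q ∈ Ioo (τ - ε / 2) (τ + ε / 2) := ⟨by linarith [hq.1], hq.2.trans_le (min_le_right _ _)⟩
  refine ⟨p, Ioo_subset_Icc_self hp1, q, Ioo_subset_Icc_self hq1, ?_⟩
  have np := hu.det_ne_zero hi' (Ioo_subset_Icc_self hp1)
  have nq := hu.det_ne_zero hi (Ioo_subset_Icc_self hq1)
  have ep := hder i hi' p hp1 hp2
  have eq := hder (i + 1) hi q hq1 hq2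
  have fp := pow_pos (hin p (Ioo_subset_Icc_self hp2)).1 2
  have fq := pow_pos (hin q (Ioo_subset_Icc_self hq2)).1 2
  -- A continuous injective function is strictly monotone, and the sign of `(g / f)'` is that of
  -- `[u, u']`; hence the signs before and after the vertex agree.
  rcases hφc.strictMonoOn_of_injOn_Icc' (by linarith) hφi with hmono | hanti
  · have s1 := hmono.monotoneOn.derivWithin_nonneg (x := p)
    have s2 := hmono.monotoneOn.derivWithin_nonneg (x := q)
    rw [ep, le_div_iff₀ fp, zero_mul, mul_nonneg_iff_of_pos_left ha0] at s1
    rw [eq, le_div_iff₀ fq, zero_mul, mul_nonneg_iff_of_pos_left ha0] at s2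
    exact mul_pos (lt_of_le_of_ne s1 np.symm) (lt_of_le_of_ne s2 nq.symm)
  · have s1 := hanti.antitoneOn.derivWithin_nonpos (x := p)
    have s2 := hanti.antitoneOn.derivWithin_nonpos (x := q)
    rw [ep, div_le_iff₀ fp, zero_mul] at s1
    rw [eq, div_le_iff₀ fq, zero_mul] at s2
    exact mul_pos_of_neg_of_neg (lt_of_le_of_ne (nonpos_of_mul_nonpos_right s1 ha0) np)
      (lt_of_le_of_ne (nonpos_of_mul_nonpos_right s2 ha0) nq)

/-- The curve `u` has a constant orientation. -/
theorem det_mul_pos (hu : IsUnitCircle N T n t u) {i : ℕ} (hi : i < 2 * n) {s : ℝ}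
    (hs : s ∈ Icc (t i) (t (i + 1))) :
    0 < det (u 0) (derivWithin u (Icc (t 0) (t (0 + 1))) 0) *
      det (u s) (derivWithin u (Icc (t i) (t (i + 1))) s) := by
  have h0 : (0 : ℝ) ∈ Icc (t 0) (t (0 + 1)) := by
    have := left_mem_Icc.2 (hu.t_lt 0 (by omega)).le
    rwa [hu.t_zero] at this ⊢
  induction i generalizing s with
  | zero => exact hu.det_mul_pos_arc hi h0 hs
  | succ i ih =>
    obtain ⟨p, hp, q, hq, hpq⟩ := hu.det_mul_pos_vertex hi
    have h1 := ih (by omega) hp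
    have h2 := hu.det_mul_pos_arc hi hq hs
    have h3 := mul_pos (mul_pos h1 hpq) h2
    have e : ∀ A B C D : ℝ, A * B * (B * C) * (C * D) = (B * C) ^ 2 * (A * D) := fun _ _ _ _ => by
      ring
    rw [e] at h3
    exact (mul_pos_iff_of_pos_left (pow_pos hpq 2)).1 h3

end IsUnitCircle

/-! ### The unit circle as a convex loop -/

theorem exists_pos_of_hasDerivWithinAt_right {f : ℝ → ℝ} {f' a b c : ℝ} (hab : a < b)
    (h : HasDerivWithinAt f f' (Icc a b) a) (hf' : 0 < f') (h0 : f a = 0) (hac : a < c) :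
    ∃ s ∈ Ioo a c, 0 < f s := by
  rw [hasDerivWithinAt_iff_tendsto_slope] at h
  have h1 : ∀ᶠ s in 𝓝[Ioo a (min b c)] a, 0 < slope f a s :=
    (h.mono_left (nhdsWithin_mono a fun s hs => ⟨⟨hs.1.le, hs.2.le.trans (min_le_left _ _)⟩, hs.1.ne'⟩)
      ).eventually (lt_mem_nhds hf')
  have : (𝓝[Ioo a (min b c)] a).NeBot := left_nhdsWithin_Ioo_neBot (lt_min hab hac)
  obtain ⟨s, hs, hsI⟩ := (h1.and self_mem_nhdsWithin).exists
  refine ⟨s, ⟨hsI.1, hsI.2.trans_le (min_le_right _ _)⟩, ?_⟩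
  rw [slope_def_field, h0, sub_zero] at hs
  exact (div_pos_iff_of_pos_right (sub_pos.2 hsI.1)).1 hs

theorem exists_neg_of_hasDerivWithinAt_left {f : ℝ → ℝ} {f' a b c : ℝ} (hab : a < b)
    (h : HasDerivWithinAt f f' (Icc a b) b) (hf' : 0 < f') (h0 : f b = 0) (hcb : c < b) :
    ∃ s ∈ Ioo c b, f s < 0 := by
  rw [hasDerivWithinAt_iff_tendsto_slope] at h
  have h1 : ∀ᶠ s in 𝓝[Ioo (max a c) b] b, 0 < slope f b s :=
    (h.mono_left (nhdsWithin_mono b fun s hs => ⟨⟨(le_max_left _ _).trans hs.1.le, hs.2.le⟩, hs.2.ne⟩)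
      ).eventually (lt_mem_nhds hf')
  have : (𝓝[Ioo (max a c) b] b).NeBot := right_nhdsWithin_Ioo_neBot (max_lt hab hcb)
  obtain ⟨s, hs, hsI⟩ := (h1.and self_mem_nhdsWithin).exists
  refine ⟨s, ⟨(le_max_right _ _).trans_lt hsI.1, hsI.2⟩, ?_⟩
  rw [slope_def_field, h0, sub_zero] at hs
  rcases div_pos_iff.1 hs with h2 | h2
  · linarith [hsI.2]
  · exact h2.1

theorem pos_on_of_ne_zero {f : ℝ → ℝ} {a b : ℝ} (hf : ContinuousOn f (Icc a b))
    (h0 : ∀ s ∈ Ioo a b, f s ≠ 0) {p : ℝ} (hp : p ∈ Ioo a b) (hfp : 0 < f p) {s : ℝ}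
    (hs : s ∈ Ioo a b) : 0 < f s := by
  by_contra hneg
  have hsub : uIcc s p ⊆ Ioo a b := ordConnected_Ioo.uIcc_subset hs hp
  obtain ⟨q, hq, hq0⟩ := intermediate_value_uIcc (hf.mono (hsub.trans Ioo_subset_Icc_self))
    (mem_uIcc.2 (Or.inl ⟨not_lt.1 hneg, hfp.le⟩) : (0 : ℝ) ∈ uIcc (f s) (f p))
  exact h0 q (hsub hq) hq0

/-- The one-sided derivative of `u` at `t 0`. -/
noncomputable def initialVelocity (t : ℕ → ℝ) (u : ℝ → ℝ × ℝ) : ℝ × ℝ :=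
  derivWithin u (Icc (t 0) (t (0 + 1))) 0

namespace IsUnitCircle

variable {N : Seminorm ℝ (ℝ × ℝ)} {T : ℝ} {n : ℕ} {t : ℕ → ℝ} {u : ℝ → ℝ × ℝ}

theorem zero_mem_arc (hu : IsUnitCircle N T n t u) : (0 : ℝ) ∈ Icc (t 0) (t (0 + 1)) := by
  have := left_mem_Icc.2 (hu.t_lt 0 (by have := hu.n_pos; omega)).le
  rwa [hu.t_zero] at this ⊢

theorem det_initial_ne_zero (hu : IsUnitCircle N T n t u) :
    det (u 0) (initialVelocity t u) ≠ 0 :=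
  hu.det_ne_zero (by have := hu.n_pos; omega) hu.zero_mem_arc

theorem isPrimitive {f : ℝ → ℝ × ℝ} (hu : IsUnitCircle N T n t u)
    (hf : IsPiecewiseSmooth (2 * n) t f) (l : ℝ × ℝ →L[ℝ] ℝ) :
    IsPrimitive (t '' Iic (2 * n)) 0 (2 * T) (fun s => l (f s)) (fun s => l (deriv f s)) := by
  have := hf.isPrimitive l
  rwa [hu.t_zero, hu.t_last] at this

theorem coord_det_pos (hu : IsUnitCircle N T n t u) {i : ℕ} (hi : i < 2 * n) {s : ℝ}
    (hs : s ∈ Icc (t i) (t (i + 1))) :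
    0 < coordX (u 0) (initialVelocity t u) (u s) *
        coordY (u 0) (initialVelocity t u) (derivWithin u (Icc (t i) (t (i + 1))) s) -
      coordY (u 0) (initialVelocity t u) (u s) *
        coordX (u 0) (initialVelocity t u) (derivWithin u (Icc (t i) (t (i + 1))) s) := by
  have h1 := hu.det_mul_pos hi hs
  change 0 < det (u 0) (initialVelocity t u) * _ at h1
  rw [det_eq_coord hu.det_initial_ne_zero (u s), ← mul_assoc] at h1
  exact (mul_pos_iff_of_pos_left (mul_self_pos.2 hu.det_initial_ne_zero)).1 h1

theorem coord_support (hu : IsUnitCircle N T n t u) {i : ℕ} (hi : i < 2 * n) {s : ℝ}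
    (hs : s ∈ Icc (t i) (t (i + 1))) {z : ℝ × ℝ} (hz : N z ≤ 1) :
    coordX (u 0) (initialVelocity t u) z *
        coordY (u 0) (initialVelocity t u) (derivWithin u (Icc (t i) (t (i + 1))) s) -
      coordY (u 0) (initialVelocity t u) z *
        coordX (u 0) (initialVelocity t u) (derivWithin u (Icc (t i) (t (i + 1))) s) ≤
    coordX (u 0) (initialVelocity t u) (u s) *
        coordY (u 0) (initialVelocity t u) (derivWithin u (Icc (t i) (t (i + 1))) s) -
      coordY (u 0) (initialVelocity t u) (u s) *
        coordX (u 0) (initialVelocity t u) (derivWithin u (Icc (t i) (t (i + 1))) s) := by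
  have h1 := hu.abs_det_le hi hs hz
  have h2 := hu.coord_det_pos hi hs
  rw [det_eq_coord hu.det_initial_ne_zero z, det_eq_coord hu.det_initial_ne_zero (u s), abs_mul,
    abs_mul] at h1
  have h3 := le_of_mul_le_mul_left h1 (abs_pos.2 hu.det_initial_ne_zero)
  rw [abs_of_pos h2] at h3
  exact (le_abs_self _).trans h3

theorem coordX_zero (hu : IsUnitCircle N T n t u) :
    coordX (u 0) (initialVelocity t u) (u 0) = 1 := by
  rw [coordX_apply, div_self hu.det_initial_ne_zero]

theorem coordY_zero : coordY (u 0) (initialVelocity t u) (u 0) = 0 := by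
  rw [coordY_apply, show det (u 0) (u 0) = 0 by unfold det; ring, zero_div]

theorem abs_coordX_le (hu : IsUnitCircle N T n t u) {s : ℝ} (hs : s ∈ Icc 0 (2 * T)) :
    |coordX (u 0) (initialVelocity t u) (u s)| ≤ 1 := by
  have h1 := hu.abs_det_le (by have := hu.n_pos; omega) hu.zero_mem_arc (hu.norm_eq hs).le
  rw [coordX_apply, abs_div]
  exact div_le_one_of_le₀ h1 (abs_nonneg _)

/-- In the basis given by the initial point and the initial velocity, `u` is a convex loop. -/
theorem exists_isConvexLoop (hu : IsUnitCircle N T n t u) :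
    ∃ m, IsConvexLoop (t '' Iic (2 * n)) m (2 * T)
      (fun s => coordX (u 0) (initialVelocity t u) (u s))
      (fun s => coordX (u 0) (initialVelocity t u) (deriv u s))
      (fun s => coordY (u 0) (initialVelocity t u) (u s))
      (fun s => coordY (u 0) (initialVelocity t u) (deriv u s)) := by
  have hT := hu.T_pos
  have h0I : (0 : ℝ) ∈ Icc 0 (2 * T) := ⟨le_rfl, by linarith⟩
  have hne := hu.det_initial_ne_zero
  have hN0 := hu.norm_eq h0I
  obtain ⟨m, hmI, hm⟩ : -u 0 ∈ u '' Icc 0 (2 * T) := by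
    rw [hu.image_eq]
    change N (-u 0) = 1
    rw [map_neg_eq_map, hN0]
  have hnn : -u 0 ≠ u 0 := by
    intro h
    have h1 : u 0 = 0 := self_eq_neg.1 h.symm
    rw [h1, map_zero] at hN0
    exact zero_ne_one hN0
  have hm0 : 0 < m := lt_of_le_of_ne hmI.1 (by rintro rfl; exact hnn hm.symm)
  have hmT : m < 2 * T := lt_of_le_of_ne hmI.2 (by rintro rfl; rw [← hu.closed] at hm; exact hnn hm.symm)
  set X := coordX (u 0) (initialVelocity t u) with hX
  set Y := coordY (u 0) (initialVelocity t u) with hY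
  have hS := IsPartition.countable (2 * n) t
  have hx := hu.isPrimitive hu.piecewiseSmooth X
  have hy := hu.isPrimitive hu.piecewiseSmooth Y
  have hX0 : X (u 0) = 1 := hu.coordX_zero
  have hY0 : Y (u 0) = 0 := coordY_zero
  have hXm : X (u m) = -1 := by rw [hm, map_neg, hX0]
  have hYm : Y (u m) = 0 := by rw [hm, map_neg, hY0, neg_zero]
  have hXT : X (u (2 * T)) = 1 := by rw [← hu.closed, hX0]
  have hYT : Y (u (2 * T)) = 0 := by rw [← hu.closed, hY0]
  have hdet : ∀ s ∈ Ioo 0 (2 * T) \ t '' Iic (2 * n),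
      0 < X (u s) * Y (deriv u s) - Y (u s) * X (deriv u s) := fun s hs => by
    obtain ⟨i, hi, his⟩ := hu.exists_mem_Ioo hs
    have := hu.coord_det_pos hi (Ioo_subset_Icc_self his)
    rwa [IsPiecewiseSmooth.derivWithin_eq his] at this
  have hsupp : ∀ s ∈ Ioo 0 (2 * T) \ t '' Iic (2 * n), ∀ σ ∈ Icc 0 (2 * T),
      X (u σ) * Y (deriv u s) - Y (u σ) * X (deriv u s) ≤
        X (u s) * Y (deriv u s) - Y (u s) * X (deriv u s) := fun s hs σ hσ => by
    obtain ⟨i, hi, his⟩ := hu.exists_mem_Ioo hs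
    have := hu.coord_support hi (Ioo_subset_Icc_self his) (hu.norm_eq hσ).le
    rwa [IsPiecewiseSmooth.derivWithin_eq his] at this
  -- A point with `Y = 0` is a multiple of `u 0` of norm one, hence `u 0` or `-u 0`, and injectivity
  -- identifies the parameter.
  have hYne : ∀ s ∈ Ioo 0 (2 * T), s ≠ m → Y (u s) ≠ 0 := fun s hs hsm h => by
    have h1 := coord_decomp hne (u s)
    rw [← hY, ← hX, h, zero_smul, add_zero] at h1
    have h2 := hu.norm_eq (Ioo_subset_Icc_self hs)
    rw [h1, map_smul_eq_mul, hN0, mul_one, Real.norm_eq_abs] at h2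
    rcases eq_or_eq_neg_of_abs_eq h2 with h3 | h3
    · rw [h3, one_smul] at h1
      exact hs.1.ne' (hu.injOn ⟨hs.1.le, hs.2⟩ ⟨le_rfl, by linarith⟩ h1)
    · rw [h3, neg_one_smul, ← hm] at h1
      exact hsm (hu.injOn ⟨hs.1.le, hs.2⟩ ⟨hm0.le, hmT⟩ h1)
  -- `Y` leaves `0` with derivative `1` and has no zero before `m`.
  have hYpos : ∀ s ∈ Ioo 0 m, 0 < Y (u s) := fun s hs => by
    have h0n : 0 < 2 * n := by have := hu.n_pos; omega
    have hd : HasDerivWithinAt u (initialVelocity t u) (Icc (t 0) (t (0 + 1))) (t 0) := by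
      have := hu.piecewiseSmooth.hasDerivWithinAt h0n (left_mem_Icc.2 (hu.t_lt 0 h0n).le)
      unfold initialVelocity
      rw [hu.t_zero] at this ⊢
      exact this
    have hd' := Y.hasFDerivAt.comp_hasDerivWithinAt _ hd
    obtain ⟨p, hp, hpY⟩ := exists_pos_of_hasDerivWithinAt_right (hu.t_lt 0 h0n) hd'
      (by rw [hY, coordY_apply, div_self hne]; exact one_pos)
      (by simp only [Function.comp_apply]; rw [hu.t_zero]; exact hY0) (by rw [hu.t_zero]; exact hm0)
    rw [hu.t_zero] at hp
    exact pos_on_of_ne_zero (hy.mono le_rfl hmT.le).cont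
      (fun q hq => hYne q ⟨hq.1, hq.2.trans hmT⟩ hq.2.ne) hp hpY hs
  -- The final one-sided velocity may differ from the initial one, but at `2T`, where `X = 1` and `Y
  -- = 0`, the positive determinant is just the derivative of `Y`.
  have hYneg : ∀ s ∈ Ioo m (2 * T), 0 < -Y (u s) := fun s hs => by
    have hk : 2 * n - 1 < 2 * n := by have := hu.n_pos; omega
    have hk1 : 2 * n - 1 + 1 = 2 * n := by omega
    have hlt := hu.t_lt _ hk
    have hd := hu.piecewiseSmooth.hasDerivWithinAt hk (right_mem_Icc.2 hlt.le)
    have hpos := hu.coord_det_pos hk (right_mem_Icc.2 hlt.le)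
    rw [← hX, ← hY] at hpos
    have hd' := Y.hasFDerivAt.comp_hasDerivWithinAt _ hd
    have hend : t (2 * n - 1 + 1) = 2 * T := by rw [hk1, hu.t_last]
    have hXe : X (u (t (2 * n - 1 + 1))) = 1 := by rw [hend]; exact hXT
    have hYe : Y (u (t (2 * n - 1 + 1))) = 0 := by rw [hend]; exact hYT
    rw [hXe, hYe, one_mul, zero_mul, sub_zero] at hpos
    obtain ⟨p, hp, hpY⟩ := exists_neg_of_hasDerivWithinAt_left hlt hd' hpos hYe
      (by rw [hend]; exact hmT)
    rw [hend] at hp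
    exact pos_on_of_ne_zero (f := fun s => -Y (u s)) (hy.mono hm0.le le_rfl).neg.cont
      (fun q hq => neg_ne_zero.2 (hYne q ⟨hm0.trans hq.1, hq.2⟩ hq.1.ne')) hp
      (neg_pos.2 hpY) hs
  refine ⟨m, ⟨?_, ?_, hx, hy, hdet⟩⟩
  · exact
      { lt := hm0
        countable := hS
        hx := hx.mono le_rfl hmT.le
        hy := hy.mono le_rfl hmT.le
        x_left := hX0
        y_left := hY0
        x_right := hXm
        y_right := hYm
        abs_x_le := fun s hs => hu.abs_coordX_le ⟨hs.1, hs.2.trans hmT.le⟩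
        y_pos := hYpos
        support := fun s hs σ hσ => hsupp s ⟨⟨hs.1.1, hs.1.2.trans hmT⟩, hs.2⟩ σ
          ⟨hσ.1, hσ.2.trans hmT.le⟩
        det_pos := fun s hs => hdet s ⟨⟨hs.1.1, hs.1.2.trans hmT⟩, hs.2⟩ }
  · exact
      { lt := hmT
        countable := hS
        hx := (hx.mono hm0.le le_rfl).neg
        hy := (hy.mono hm0.le le_rfl).neg
        x_left := by rw [hXm, neg_neg]
        y_left := by rw [hYm, neg_zero]
        x_right := by rw [hXT]
        y_right := by rw [hYT, neg_zero]
        abs_x_le := fun s hs => by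
          rw [abs_neg]
          exact hu.abs_coordX_le ⟨hm0.le.trans hs.1, hs.2⟩
        y_pos := hYneg
        support := fun s hs σ hσ => by
          have := hsupp s ⟨⟨hm0.trans hs.1.1, hs.1.2⟩, hs.2⟩ σ ⟨hm0.le.trans hσ.1, hσ.2⟩
          linarith
        det_pos := fun s hs => by
          have := hdet s ⟨⟨hm0.trans hs.1.1, hs.1.2⟩, hs.2⟩
          linarith }

end IsUnitCircle

/-! ### Straight arcs and arcs parallel to the initial velocity -/

theorem det_swap (a b : ℝ × ℝ) : det b a = -det a b := by
  unfold det
  ring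

theorem det_eq_zero_trans {a b c : ℝ × ℝ} (hb : b ≠ 0) (hab : det a b = 0) (hbc : det b c = 0) :
    det a c = 0 := by
  by_contra h
  refine hb ?_
  have h1 : det a c • b = det a b • c + det b c • a := by
    ext <;> simp [det] <;> ring
  rw [hab, hbc, zero_smul, zero_smul, add_zero] at h1
  exact (smul_eq_zero.1 h1).resolve_left h

/-- Over `(a, b)`, the curve `u` is parallel to `d`. -/
def IsFlatArc (u : ℝ → ℝ × ℝ) (d : ℝ × ℝ) (a b : ℝ) : Prop :=
  ∀ s ∈ Ioo a b, det (deriv u s) d = 0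

namespace IsUnitCircle

variable {N : Seminorm ℝ (ℝ × ℝ)} {T : ℝ} {n : ℕ} {t : ℕ → ℝ} {u : ℝ → ℝ × ℝ}

theorem hasDerivAt (hu : IsUnitCircle N T n t u) {i : ℕ} (hi : i < 2 * n) {s : ℝ}
    (hs : s ∈ Ioo (t i) (t (i + 1))) : HasDerivAt u (deriv u s) s :=
  hu.piecewiseSmooth.hasDerivAt hi hs

theorem deriv_ne (hu : IsUnitCircle N T n t u) {i : ℕ} (hi : i < 2 * n) {s : ℝ}
    (hs : s ∈ Ioo (t i) (t (i + 1))) : deriv u s ≠ 0 := by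
  rw [← IsPiecewiseSmooth.derivWithin_eq hs]
  exact hu.deriv_ne_zero i hi s (Ioo_subset_Icc_self hs)

/-- Differentiating `[u'(s), u'(z)] = 0` at `z = s` gives `[u', u''] = 0`, so the arc is not
strictly convex. -/
theorem straight_of_eventually_parallel (hu : IsUnitCircle N T n t u) {i : ℕ} (hi : i < 2 * n)
    {s : ℝ} (hs : s ∈ Ioo (t i) (t (i + 1)))
    (h : ∀ᶠ z in 𝓝 s, det (deriv u s) (deriv u z) = 0) : IsStraightArc u (t i) (t (i + 1)) := by
  refine (hu.arcs i hi).resolve_left fun hc => hc s (Ioo_subset_Icc_self hs) ?_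
  rw [IsPiecewiseSmooth.derivWithin_eq hs]
  have h1 := (detLeft (deriv u s)).hasFDerivAt.comp_hasDerivAt s
    (hu.piecewiseSmooth.hasDerivAt_deriv hi hs)
  have h2 : HasDerivAt (detLeft (deriv u s) ∘ deriv u) 0 s :=
    (hasDerivAt_const s (0 : ℝ)).congr_of_eventuallyEq (by
      filter_upwards [h] with z hz
      rw [Function.comp_apply, detLeft_apply, hz])
  rw [← detLeft_apply]
  exact h1.unique h2

theorem exists_eq_of_straight {i : ℕ} (h : IsStraightArc u (t i) (t (i + 1))) {s : ℝ}
    (hs : s ∈ Icc (t i) (t (i + 1))) : ∃ θ : ℝ, u s = u (t i) + θ • (u (t (i + 1)) - u (t i)) := by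
  have h1 : u s ∈ segment ℝ (u (t i)) (u (t (i + 1))) := by
    rw [← h]
    exact mem_image_of_mem u hs
  rw [segment_eq_image'] at h1
  obtain ⟨θ, -, hθ⟩ := h1
  exact ⟨θ, hθ.symm⟩

theorem det_deriv_of_straight (hu : IsUnitCircle N T n t u) {i : ℕ} (hi : i < 2 * n)
    (h : IsStraightArc u (t i) (t (i + 1))) {s : ℝ} (hs : s ∈ Ioo (t i) (t (i + 1))) :
    det (deriv u s) (u (t (i + 1)) - u (t i)) = 0 := by
  have h1 := (detRight (u (t (i + 1)) - u (t i))).hasFDerivAt.comp_hasDerivAt s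
    (hu.hasDerivAt hi hs)
  have h2 : HasDerivAt (detRight (u (t (i + 1)) - u (t i)) ∘ u) 0 s :=
    (hasDerivAt_const s (det (u (t i)) (u (t (i + 1)) - u (t i)))).congr_of_eventuallyEq (by
      filter_upwards [Ioo_mem_nhds hs.1 hs.2] with z hz
      obtain ⟨θ, hθ⟩ := exists_eq_of_straight h (Ioo_subset_Icc_self hz)
      rw [Function.comp_apply, detRight_apply, hθ]
      simp [det]
      ring)
  rw [← detRight_apply]
  exact h1.unique h2

theorem eventually_mem_arc {i : ℕ} {s : ℝ} (hs : s ∈ Ioo (t i) (t (i + 1))) :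
    ∀ᶠ z in 𝓝 s, z ∈ Ioo (t i) (t (i + 1)) := Ioo_mem_nhds hs.1 hs.2

/-- The curve `u` is not straight near a vertex between two arcs. -/
theorem not_parallel_at_vertex (hu : IsUnitCircle N T n t u) {i : ℕ} (hi : i + 1 < 2 * n) {δ : ℝ}
    (hδ : 0 < δ)
    (h : ∀ p ∈ Ioo (t (i + 1) - δ) (t (i + 1) + δ) \ t '' Iic (2 * n),
      ∀ q ∈ Ioo (t (i + 1) - δ) (t (i + 1) + δ) \ t '' Iic (2 * n),
        det (deriv u p) (deriv u q) = 0) : False := by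
  have hi' : i < 2 * n := by omega
  have l1 := hu.t_lt i hi'
  have l2 := hu.t_lt (i + 1) hi
  obtain ⟨p, hp⟩ := nonempty_Ioo.2 (max_lt l1 (by linarith : t (i + 1) - δ < t (i + 1)))
  obtain ⟨q, hq⟩ := nonempty_Ioo.2 (lt_min l2 (by linarith : t (i + 1) < t (i + 1) + δ))
  have hp1 : p ∈ Ioo (t i) (t (i + 1)) := ⟨(le_max_left _ _).trans_lt hp.1, hp.2⟩
  have hp2 : p ∈ Ioo (t (i + 1) - δ) (t (i + 1) + δ) :=
    ⟨(le_max_right _ _).trans_lt hp.1, by linarith [hp.2]⟩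
  have hq1 : q ∈ Ioo (t (i + 1)) (t (i + 1 + 1)) := ⟨hq.1, hq.2.trans_le (min_le_left _ _)⟩
  have hq2 : q ∈ Ioo (t (i + 1) - δ) (t (i + 1) + δ) :=
    ⟨by linarith [hq.1], hq.2.trans_le (min_le_right _ _)⟩
  have hpS := (hu.Ioo_subset hi' hp1).2
  have hqS := (hu.Ioo_subset hi hq1).2
  -- Both adjacent arcs are straight and have the same direction, which contradicts `vertices`.
  have s1 : IsStraightArc u (t i) (t (i + 1)) := hu.straight_of_eventually_parallel hi' hp1 (by
    filter_upwards [eventually_mem_arc hp1, Ioo_mem_nhds hp2.1 hp2.2] with z hz hz'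
    exact h p ⟨hp2, hpS⟩ z ⟨hz', (hu.Ioo_subset hi' hz).2⟩)
  have s2 : IsStraightArc u (t (i + 1)) (t (i + 1 + 1)) :=
    hu.straight_of_eventually_parallel hi hq1 (by
      filter_upwards [eventually_mem_arc hq1, Ioo_mem_nhds hq2.1 hq2.2] with z hz hz'
      exact h q ⟨hq2, hqS⟩ z ⟨hz', (hu.Ioo_subset hi hz).2⟩)
  refine hu.vertices i hi' (i + 1) (Nat.mod_eq_of_lt hi).symm s1 s2 ?_
  have e1 := hu.det_deriv_of_straight hi' s1 hp1
  have e2 := hu.det_deriv_of_straight hi s2 hq1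
  have e3 := h p ⟨hp2, hpS⟩ q ⟨hq2, hqS⟩
  have e1' : det (u (t (i + 1)) - u (t i)) (deriv u p) = 0 := by rw [det_swap, e1, neg_zero]
  exact det_eq_zero_trans (hu.deriv_ne hi' hp1) e1' (det_eq_zero_trans (hu.deriv_ne hi hq1) e3 e2)

theorem straight_of_flat (hu : IsUnitCircle N T n t u) {d : ℝ × ℝ} (hd : d ≠ 0) {i : ℕ}
    (hi : i < 2 * n) (h : IsFlatArc u d (t i) (t (i + 1))) :
    IsStraightArc u (t i) (t (i + 1)) ∧ det (u (t (i + 1)) - u (t i)) d = 0 := by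
  obtain ⟨s, hs⟩ := nonempty_Ioo.2 (hu.t_lt i hi)
  have h1 : IsStraightArc u (t i) (t (i + 1)) := hu.straight_of_eventually_parallel hi hs (by
    filter_upwards [eventually_mem_arc hs] with z hz
    exact det_eq_zero_trans hd (h s hs) (by rw [det_swap, h z hz, neg_zero]))
  refine ⟨h1, det_eq_zero_trans (hu.deriv_ne hi hs) ?_ (h s hs)⟩
  rw [det_swap, hu.det_deriv_of_straight hi h1 hs, neg_zero]

/-- Two consecutive arcs are not both parallel to `d`. -/
theorem not_flat_consecutive (hu : IsUnitCircle N T n t u) {d : ℝ × ℝ} (hd : d ≠ 0) {i j : ℕ}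
    (hi : i < 2 * n) (hj : j = (i + 1) % (2 * n)) (h1 : IsFlatArc u d (t i) (t (i + 1)))
    (h2 : IsFlatArc u d (t j) (t (j + 1))) : False := by
  have hj' : j < 2 * n := hj ▸ Nat.mod_lt _ (by omega)
  obtain ⟨a1, a2⟩ := hu.straight_of_flat hd hi h1
  obtain ⟨b1, b2⟩ := hu.straight_of_flat hd hj' h2
  exact hu.vertices i hi j hj a1 b1 (det_eq_zero_trans hd a2 (by rw [det_swap, b2, neg_zero]))

theorem initialVelocity_ne_zero (hu : IsUnitCircle N T n t u) : initialVelocity t u ≠ 0 :=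
  hu.deriv_ne_zero 0 (by have := hu.n_pos; omega) 0 hu.zero_mem_arc

theorem isFlatArc_of_const (hu : IsUnitCircle N T n t u) {i : ℕ} (hi : i < 2 * n) {ξ : ℝ}
    (h : ∀ s ∈ Ioo (t i) (t (i + 1)), coordX (u 0) (initialVelocity t u) (u s) = ξ) :
    IsFlatArc u (initialVelocity t u) (t i) (t (i + 1)) := by
  intro s hs
  have h1 := (coordX (u 0) (initialVelocity t u)).hasFDerivAt.comp_hasDerivAt s
    (hu.hasDerivAt hi hs)
  have h2 : HasDerivAt (coordX (u 0) (initialVelocity t u) ∘ u) 0 s :=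
    (hasDerivAt_const s ξ).congr_of_eventuallyEq (by
      filter_upwards [eventually_mem_arc hs] with z hz using h z hz)
  have h3 := h1.unique h2
  rw [coordX_apply, div_eq_zero_iff] at h3
  exact h3.resolve_right hu.det_initial_ne_zero

/-- A line parallel to the initial velocity supports the unit ball only at `x = ±1`: test it at `u
0` and `-u 0`. -/
theorem coordX_eq_of_deriv (hu : IsUnitCircle N T n t u) {i : ℕ} (hi : i < 2 * n) {s : ℝ}
    (hs : s ∈ Ioo (t i) (t (i + 1)))
    (h : coordX (u 0) (initialVelocity t u) (deriv u s) = 0) :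
    coordX (u 0) (initialVelocity t u) (u s) = 1 ∨
      coordX (u 0) (initialVelocity t u) (u s) = -1 := by
  have hN := hu.norm_eq (s := 0) ⟨le_rfl, by linarith [hu.T_pos]⟩
  have hs' := Ioo_subset_Icc_self hs
  have h1 := hu.coord_support hi hs' hN.le
  have h2 := hu.coord_support hi hs' (z := -u 0) (by rw [map_neg_eq_map, hN])
  have h3 := hu.coord_det_pos hi hs'
  have h4 := hu.abs_coordX_le (Ioo_subset_Icc_self (hu.Ioo_subset hi hs).1)
  rw [IsPiecewiseSmooth.derivWithin_eq hs] at h1 h2 h3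
  rw [map_neg, map_neg] at h2
  rw [hu.coordX_zero, coordY_zero, h] at h1 h2
  rw [h] at h3
  obtain ⟨h5, h6⟩ := abs_le.1 h4
  by_contra hne
  push Not at hne
  have h7 := lt_of_le_of_ne h6 hne.1
  have h8 := lt_of_le_of_ne h5 hne.2.symm
  rcases lt_trichotomy (coordY (u 0) (initialVelocity t u) (deriv u s)) 0 with h9 | h9 | h9
  · nlinarith
  · rw [h9] at h3
    simp at h3
  · nlinarith

/-- At most one arc lies on each of the lines `x = 1` and `x = -1`. -/
theorem flat_arc_unique (hu : IsUnitCircle N T n t u) {i j : ℕ} (hij : i < j) (hj : j < 2 * n)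
    (hfi : IsFlatArc u (initialVelocity t u) (t i) (t (i + 1)))
    (hfj : IsFlatArc u (initialVelocity t u) (t j) (t (j + 1))) {p q : ℝ}
    (hp : p ∈ Ioo (t i) (t (i + 1))) (hq : q ∈ Ioo (t j) (t (j + 1)))
    (hpq : coordX (u 0) (initialVelocity t u) (u p) = coordX (u 0) (initialVelocity t u) (u q)) :
    False := by
  have hi : i < 2 * n := hij.trans hj
  have hd := hu.initialVelocity_ne_zero
  obtain ⟨m, hm⟩ := hu.exists_isConvexLoop
  have a1 := hm.upper.antitoneOn
  have a2 := hm.lower.antitoneOn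
  simp only [AntitoneOn] at a1 a2
  have hpI := (hu.Ioo_subset hi hp).1
  have hqI := (hu.Ioo_subset hj hq).1
  have hpq' : p < q := hp.2.trans_le ((hu.partition.mono (Nat.succ_le_of_lt hij) hj.le).trans hq.1.le)
  -- If `x` is constant from `p` to `q`, the arc after the `i`-th is also parallel to the initial
  -- velocity.
  have consecutive : ∀ ξ : ℝ, (∀ σ ∈ Icc p q, coordX (u 0) (initialVelocity t u) (u σ) = ξ) →
      False := by
    intro ξ hξ
    refine hu.not_flat_consecutive hd hi (j := i + 1) (Nat.mod_eq_of_lt (by omega)).symm hfi ?_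
    rcases (Nat.succ_le_of_lt hij).eq_or_lt with h | h
    · simp only [Nat.succ_eq_add_one] at h
      rwa [h]
    · refine hu.isFlatArc_of_const (by omega) fun σ hσ => hξ σ ⟨hp.2.le.trans hσ.1.le, ?_⟩
      exact hσ.2.le.trans ((hu.partition.mono (Nat.succ_le_of_lt h) hj.le).trans hq.1.le)
  have hX : coordX (u 0) (initialVelocity t u) (deriv u p) = 0 := by
    rw [coordX_apply, hfi p hp, zero_div]
  rcases hu.coordX_eq_of_deriv hi hp hX with hξ | hξ
  · rcases le_total q m with hqm | hqm
    · refine consecutive 1 fun σ hσ => le_antisymm ?_ ?_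
      · exact (abs_le.1 (hu.abs_coordX_le ⟨hpI.1.le.trans hσ.1, hσ.2.trans hqI.2.le⟩)).2
      · rw [← hξ, hpq]
        exact a1 ⟨hpI.1.le.trans hσ.1, hσ.2.trans hqm⟩ ⟨hqI.1.le, hqm⟩ hσ.2
    rcases le_total m p with hmp | hmp
    · refine consecutive 1 fun σ hσ => le_antisymm ?_ ?_
      · exact (abs_le.1 (hu.abs_coordX_le ⟨hpI.1.le.trans hσ.1, hσ.2.trans hqI.2.le⟩)).2
      · rw [← hξ]
        exact neg_le_neg_iff.1 (a2 ⟨hmp, hpI.2.le⟩ ⟨hmp.trans hσ.1, hσ.2.trans hqI.2.le⟩ hσ.1)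
    -- Here `p` and `q` lie on different halves with `x = 1`, so `x = 1` also from `0` to `p` and
    -- from `q` to `2T`: the first and last arcs are flat and cyclically consecutive.
    have f0 : IsFlatArc u (initialVelocity t u) (t 0) (t (0 + 1)) := by
      rcases Nat.eq_zero_or_pos i with h | h
      · rwa [h] at hfi
      · refine hu.isFlatArc_of_const (ξ := 1) (by omega) fun σ hσ => ?_
        have hσ0 := (hu.Ioo_subset (by omega) hσ).1
        have hσp : σ ≤ p := hσ.2.le.trans ((hu.partition.mono h hi.le).trans hp.1.le)
        refine le_antisymm (abs_le.1 (hu.abs_coordX_le (Ioo_subset_Icc_self hσ0))).2 ?_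
        rw [← hξ]
        exact a1 ⟨hσ0.1.le, hσp.trans hmp⟩ ⟨hpI.1.le, hmp⟩ hσp
    have f1 : IsFlatArc u (initialVelocity t u) (t (2 * n - 1)) (t (2 * n - 1 + 1)) := by
      rcases eq_or_ne j (2 * n - 1) with h | h
      · rwa [h] at hfj
      · refine hu.isFlatArc_of_const (ξ := 1) (by omega) fun σ hσ => ?_
        have hσ0 := (hu.Ioo_subset (by omega) hσ).1
        have hσq : q ≤ σ := hq.2.le.trans
          ((hu.partition.mono (by omega : j + 1 ≤ 2 * n - 1) (by omega)).trans hσ.1.le)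
        refine le_antisymm (abs_le.1 (hu.abs_coordX_le (Ioo_subset_Icc_self hσ0))).2 ?_
        rw [← hξ, hpq]
        exact neg_le_neg_iff.1 (a2 ⟨hqm, hqI.2.le⟩ ⟨hqm.trans hσq, hσ0.2.le⟩ hσq)
    refine hu.not_flat_consecutive hd (i := 2 * n - 1) (j := 0) (by omega) ?_ f1 f0
    rw [show 2 * n - 1 + 1 = 2 * n by omega, Nat.mod_self]
  · refine consecutive (-1) fun σ hσ => le_antisymm ?_ ?_
    · rcases le_total σ m with h | h
      · rw [← hξ]
        exact a1 ⟨hpI.1.le, hσ.1.trans h⟩ ⟨hpI.1.le.trans hσ.1, h⟩ hσ.1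
      · rw [← hξ, hpq]
        exact neg_le_neg_iff.1 (a2 ⟨h, hσ.2.trans hqI.2.le⟩ ⟨h.trans hσ.2, hqI.2.le⟩ hσ.2)
    · exact (abs_le.1 (hu.abs_coordX_le ⟨hpI.1.le.trans hσ.1, hσ.2.trans hqI.2.le⟩)).1

end IsUnitCircle

/-! ### Admissible curves and the case of equality -/

namespace IsAdmissible

variable {N : Seminorm ℝ (ℝ × ℝ)} {T : ℝ} {n : ℕ} {t : ℕ → ℝ} {u γ : ℝ → ℝ × ℝ} {r : ℝ → ℝ}

theorem piecewiseSmooth (hγ : IsAdmissible T n t u γ r) (hu : IsUnitCircle N T n t u) :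
    IsPiecewiseSmooth (2 * n) t γ := ⟨hu.t_lt, hγ.smooth⟩

theorem deriv_eq_off (hγ : IsAdmissible T n t u γ r) (hu : IsUnitCircle N T n t u) {s : ℝ}
    (hs : s ∈ Ioo 0 (2 * T) \ t '' Iic (2 * n)) : deriv γ s = r s • deriv u s := by
  obtain ⟨i, hi, his⟩ := hu.exists_mem_Ioo hs
  exact hγ.deriv_eq i hi s his

theorem isPrimitive (hγ : IsAdmissible T n t u γ r) (hu : IsUnitCircle N T n t u)
    (l : ℝ × ℝ →L[ℝ] ℝ) :
    IsPrimitive (t '' Iic (2 * n)) 0 (2 * T) (fun s => l (γ s)) (fun s => r s * l (deriv u s)) :=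
  (hu.isPrimitive (hγ.piecewiseSmooth hu) l).congr fun s hs => by
    rw [hγ.deriv_eq_off hu hs, map_smul, smul_eq_mul]

theorem exists_bound (hγ : IsAdmissible T n t u γ r) (hu : IsUnitCircle N T n t u) :
    ∃ C, ∀ s ∈ Ioo 0 (2 * T) \ t '' Iic (2 * n), |r s| ≤ C := by
  obtain ⟨K, hK⟩ := (hγ.piecewiseSmooth hu).exists_bound
  obtain ⟨B, hB⟩ := hu.piecewiseSmooth.exists_lower_bound hu.deriv_ne_zero
  refine ⟨K * B, fun s hs => ?_⟩
  obtain ⟨i, hi, his⟩ := hu.exists_mem_Ioo hs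
  have h1 := hK i hi s his
  have h2 := hB i hi s his
  have h3 := norm_ne_zero_iff.2 (hu.deriv_ne hi his)
  have h4 : |r s| = ‖deriv γ s‖ * ‖deriv u s‖⁻¹ := by
    rw [hγ.deriv_eq i hi s his, norm_smul, Real.norm_eq_abs, mul_assoc, mul_inv_cancel₀ h3, mul_one]
  rw [h4]
  exact mul_le_mul h1 h2 (by positivity) ((norm_nonneg _).trans h1)

theorem area_eq (hγ : IsAdmissible T n t u γ r) (hu : IsUnitCircle N T n t u) :
    area T γ = 1 / 2 * (det (u 0) (initialVelocity t u) *
      ∫ s in 0..(2 * T), (coordX (u 0) (initialVelocity t u) (γ s) *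
          (r s * coordY (u 0) (initialVelocity t u) (deriv u s)) -
        coordY (u 0) (initialVelocity t u) (γ s) *
          (r s * coordX (u 0) (initialVelocity t u) (deriv u s)))) := by
  rw [area, mixedArea]
  congr 1
  rw [← intervalIntegral.integral_const_mul]
  refine integral_congr_off_countable (IsPartition.countable (2 * n) t)
    (by linarith [hu.T_pos]) fun s hs => ?_
  rw [hγ.deriv_eq_off hu hs, det_eq_coord hu.det_initial_ne_zero, map_smul, map_smul, smul_eq_mul,
    smul_eq_mul]

theorem dualLength_eq (hu : IsUnitCircle N T n t u) (r : ℝ → ℝ) :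
    dualLength T u r = det (u 0) (initialVelocity t u) *
      ∫ s in 0..(2 * T), (coordX (u 0) (initialVelocity t u) (u s) *
          (r s * coordY (u 0) (initialVelocity t u) (deriv u s)) -
        coordY (u 0) (initialVelocity t u) (u s) *
          (r s * coordX (u 0) (initialVelocity t u) (deriv u s))) := by
  rw [dualLength, ← intervalIntegral.integral_const_mul]
  congr 1
  ext s
  rw [det_eq_coord hu.det_initial_ne_zero]
  ring

/-- If the first coordinate of `γ - c u` is constant except where `u` is straight then it is
constant. -/
theorem coordX_sub_eq_zero (hγ : IsAdmissible T n t u γ r) (hu : IsUnitCircle N T n t u) {c p : ℝ}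
    (h : ∀ s ∈ Icc 0 (2 * T), coordX (u 0) (initialVelocity t u) (γ s) -
        c * coordX (u 0) (initialVelocity t u) (u s) - p ≠ 0 → s ∈ Ioo 0 (2 * T) ∧
      ∃ δ > 0, ∀ p ∈ Ioo (s - δ) (s + δ) \ t '' Iic (2 * n),
        ∀ q ∈ Ioo (s - δ) (s + δ) \ t '' Iic (2 * n), det (deriv u p) (deriv u q) = 0) :
    ∀ s ∈ Icc 0 (2 * T), coordX (u 0) (initialVelocity t u) (γ s) -
        c * coordX (u 0) (initialVelocity t u) (u s) - p = 0 := by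
  set X := coordX (u 0) (initialVelocity t u) with hX
  set W : ℝ → ℝ := fun s => X (γ s) - c * X (u s) - p with hW
  have hS := IsPartition.countable (2 * n) t
  have hWp : IsPrimitive (t '' Iic (2 * n)) 0 (2 * T) W (fun s => (r s - c) * X (deriv u s)) := by
    have := (((hγ.isPrimitive hu X).add
      ((hu.isPrimitive hu.piecewiseSmooth X).const_mul (-c))).add_const (-p)).congr
      (g' := fun s => (r s - c) * X (deriv u s)) fun s _ => by ring
    convert this using 2
    simp only [hW]
    ring
  have hvert : ∀ k, k ≤ 2 * n → W (t k) = 0 := by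
    intro k hk
    by_contra hne
    have hkI : t k ∈ Icc 0 (2 * T) := by
      rw [← hu.t_zero, ← hu.t_last]
      exact ⟨hu.partition.mono (Nat.zero_le k) hk, hu.partition.mono hk le_rfl⟩
    obtain ⟨h1, δ, hδ, h2⟩ := h (t k) hkI hne
    have hk0 : k ≠ 0 := by
      rintro rfl
      exact h1.1.ne' hu.t_zero
    have hkn : k ≠ 2 * n := by
      rintro rfl
      exact h1.2.ne hu.t_last
    obtain ⟨i, rfl⟩ := Nat.exists_eq_succ_of_ne_zero hk0
    exact hu.not_parallel_at_vertex (i := i) (by omega) hδ h2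
  have hopen : ∀ i < 2 * n, ∀ s ∈ Ioo (t i) (t (i + 1)), W s = 0 := by
    intro i hi s hs
    by_contra hne
    obtain ⟨-, δ, hδ, h2⟩ := h s (hu.Icc_subset hi (Ioo_subset_Icc_self hs)) hne
    have hst : IsStraightArc u (t i) (t (i + 1)) := hu.straight_of_eventually_parallel hi hs (by
      filter_upwards [IsUnitCircle.eventually_mem_arc hs,
        Ioo_mem_nhds (by linarith : s - δ < s) (by linarith : s < s + δ)] with z hz hz'
      exact h2 s ⟨⟨by linarith, by linarith⟩, (hu.Ioo_subset hi hs).2⟩ z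
        ⟨hz', (hu.Ioo_subset hi hz).2⟩)
    obtain ⟨k, hk⟩ := hγ.straight i hi hst
    have hle := (hu.t_lt i hi).le
    have hsub := hu.Icc_subset hi
    have h0 := (hsub (left_mem_Icc.2 hle)).1
    have hT := (hsub (right_mem_Icc.2 hle)).2
    -- As `r = k` on a straight arc, `W` is an affine function of `X ∘ u`, hence affine along the
    -- segment; it vanishes at both ends.
    have hconst : ∀ q ∈ Icc (t i) (t (i + 1)),
        W q + -(k - c) * X (u q) = W (t i) + -(k - c) * X (u (t i)) := by
      intro q hq
      refine ((hWp.add ((hu.isPrimitive hu.piecewiseSmooth X).const_mul (-(k - c)))).mono h0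
        hT).eq_of_deriv_eq_zero hS (fun z hz => ?_) hq
      rw [hk z hz.1]
      ring
    have e1 := hconst _ (right_mem_Icc.2 hle)
    have e2 := hconst s (Ioo_subset_Icc_self hs)
    rw [hvert i hi.le] at e1 e2
    rw [hvert (i + 1) (Nat.succ_le_of_lt hi)] at e1
    obtain ⟨θ, hθ⟩ := IsUnitCircle.exists_eq_of_straight hst (Ioo_subset_Icc_self hs)
    have e3 : X (u s) = X (u (t i)) + θ * (X (u (t (i + 1))) - X (u (t i))) := by
      rw [hθ, map_add, map_smul, map_sub, smul_eq_mul]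
    rw [e3] at e2
    refine hne ?_
    linear_combination e2 - θ * e1
  intro s hs
  obtain ⟨i, hi, his⟩ := hu.exists_mem_Icc hs
  rcases his.1.eq_or_lt with h1 | h1
  · rw [← h1]
    exact hvert i hi.le
  rcases his.2.eq_or_lt with h2 | h2
  · rw [h2]
    exact hvert (i + 1) (Nat.succ_le_of_lt hi)
  exact hopen i hi s ⟨h1, h2⟩

/-- If the first coordinate of `γ - c u` is constant, the arcs over which `γ - c u` is not constant
are parallel to the initial velocity. -/
theorem flat_of_ne (hγ : IsAdmissible T n t u γ r) (hu : IsUnitCircle N T n t u) {c p : ℝ}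
    (h : ∀ s ∈ Icc 0 (2 * T), coordX (u 0) (initialVelocity t u) (γ s) -
        c * coordX (u 0) (initialVelocity t u) (u s) - p = 0) {i : ℕ} (hi : i < 2 * n) {s : ℝ}
    (hs : s ∈ Ioo (t i) (t (i + 1))) (hr : r s - c ≠ 0) :
    IsFlatArc u (initialVelocity t u) (t i) (t (i + 1)) ∧
      ∃ k, k ≠ 0 ∧ ∀ z ∈ Ioo (t i) (t (i + 1)), r z - c = k := by
  set X := coordX (u 0) (initialVelocity t u) with hX
  have hprod : ∀ z ∈ Ioo (t i) (t (i + 1)), (r z - c) * X (deriv u z) = 0 := by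
    intro z hz
    have h1 := X.hasFDerivAt.comp_hasDerivAt z (hu.hasDerivAt hi hz)
    have h2 := X.hasFDerivAt.comp_hasDerivAt z ((hγ.piecewiseSmooth hu).hasDerivAt hi hz)
    have h3 := h2.sub (h1.const_mul c)
    have h4 : HasDerivAt (fun z => X (γ z) - c * X (u z)) 0 z :=
      (hasDerivAt_const z p).congr_of_eventuallyEq (by
        filter_upwards [IsUnitCircle.eventually_mem_arc hz] with w hw
        linarith [h w (hu.Icc_subset hi (Ioo_subset_Icc_self hw))])
    have h5 := h3.unique h4
    rw [hγ.deriv_eq i hi z hz, map_smul, smul_eq_mul] at h5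
    linarith
  have hXs : X (deriv u s) = 0 := (mul_eq_zero.1 (hprod s hs)).resolve_left hr
  have hst : IsStraightArc u (t i) (t (i + 1)) := by
    refine (hu.arcs i hi).resolve_left fun hc => ?_
    have h1 := hc s (Ioo_subset_Icc_self hs)
    rw [IsPiecewiseSmooth.derivWithin_eq hs, det_eq_coord hu.det_initial_ne_zero, ← hX, hXs,
      zero_mul, zero_sub] at h1
    have hd := hu.piecewiseSmooth.hasDerivAt_deriv hi hs
    -- On a strictly convex arc the zero of `X (u')` at `s` is isolated, so `r = c` nearby.
    -- Continuity is applied to `γ' - c u'`, since `r` itself is not assumed continuous.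
    have hne : X (derivWithin (derivWithin u (Icc (t i) (t (i + 1)))) (Icc (t i) (t (i + 1))) s) ≠ 0 := by
      intro h0
      rw [h0] at h1
      simp at h1
    have hev : ∀ᶠ z in 𝓝[≠] s, X (deriv u z) ≠ 0 :=
      (X.hasFDerivAt.comp_hasDerivAt s hd).eventually_ne hne
    have hγd := (hγ.piecewiseSmooth hu).hasDerivAt_deriv hi hs
    have hcont : ContinuousAt (fun z => deriv γ z - c • deriv u z) s :=
      hγd.continuousAt.sub (hd.continuousAt.const_smul c)
    have hlim : Tendsto (fun z => deriv γ z - c • deriv u z) (𝓝[≠] s) (𝓝 0) := by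
      refine tendsto_const_nhds.congr' ?_
      filter_upwards [hev, (IsUnitCircle.eventually_mem_arc hs).filter_mono nhdsWithin_le_nhds]
        with z hz hz'
      rw [hγ.deriv_eq i hi z hz', ← sub_smul,
        (mul_eq_zero.1 (hprod z hz')).resolve_right hz, zero_smul]
    have h0 := tendsto_nhds_unique (hcont.tendsto.mono_left nhdsWithin_le_nhds) hlim
    simp only [hγ.deriv_eq i hi s hs, ← sub_smul] at h0
    exact (smul_eq_zero.1 h0).elim hr (hu.deriv_ne hi hs)
  obtain ⟨k, hk⟩ := hγ.straight i hi hst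
  have hkc : k - c ≠ 0 := by rwa [← hk s hs]
  refine ⟨fun z hz => ?_, k - c, hkc, fun z hz => by rw [hk z hz]⟩
  have h1 := hprod z hz
  rw [hk z hz] at h1
  have h2 := (mul_eq_zero.1 h1).resolve_left hkc
  rw [hX, coordX_apply, div_eq_zero_iff] at h2
  exact h2.resolve_right hu.det_initial_ne_zero

/-- The only arcs with `r ≠ c` are flat, at most one on each line `x = ±1`. Adding `ξ` times the
closing condition `∫ (r - c) y' = 0` to `hint` cancels the arc on `x = -ξ` and isolates the one on
`x = ξ`, whose contribution is not zero. -/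
theorem radius_eq (hγ : IsAdmissible T n t u γ r) (hu : IsUnitCircle N T n t u) {c p : ℝ}
    (h : ∀ s ∈ Icc 0 (2 * T), coordX (u 0) (initialVelocity t u) (γ s) -
        c * coordX (u 0) (initialVelocity t u) (u s) - p = 0)
    (hint : ∫ s in 0..(2 * T), (coordX (u 0) (initialVelocity t u) (u s) *
          ((r s - c) * coordY (u 0) (initialVelocity t u) (deriv u s)) -
        coordY (u 0) (initialVelocity t u) (u s) *
          ((r s - c) * coordX (u 0) (initialVelocity t u) (deriv u s))) = 0) :
    ∀ i < 2 * n, ∀ s ∈ Ioo (t i) (t (i + 1)), r s = c := by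
  intro i hi s hs
  by_contra hrc
  have hr : r s - c ≠ 0 := sub_ne_zero.2 hrc
  obtain ⟨hflat, k, hk0, hk⟩ := hγ.flat_of_ne hu h hi hs hr
  set X := coordX (u 0) (initialVelocity t u) with hX
  set Y := coordY (u 0) (initialVelocity t u) with hY
  have hS := IsPartition.countable (2 * n) t
  have hT : 0 ≤ 2 * T := by linarith [hu.T_pos]
  have hXflat : ∀ {j : ℕ}, IsFlatArc u (initialVelocity t u) (t j) (t (j + 1)) →
      ∀ z ∈ Ioo (t j) (t (j + 1)), X (deriv u z) = 0 := fun hf z hz => by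
    rw [hX, coordX_apply, hf z hz, zero_div]
  set ξ := X (u s) with hξ
  have hξ1 : ξ = 1 ∨ ξ = -1 := hu.coordX_eq_of_deriv hi hs (hXflat hflat s hs)
  have hx := hu.isPrimitive hu.piecewiseSmooth X
  have hy := hu.isPrimitive hu.piecewiseSmooth Y
  have hV : IsPrimitive (t '' Iic (2 * n)) 0 (2 * T) (fun s => Y (γ s) - c * Y (u s))
      (fun s => (r s - c) * Y (deriv u s)) := by
    have := ((hγ.isPrimitive hu Y).add (hy.const_mul (-c))).congr
      (g' := fun s => (r s - c) * Y (deriv u s)) fun s _ => by ring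
    convert this using 2
    ring
  have hVint : ∫ s in 0..(2 * T), (r s - c) * Y (deriv u s) = 0 := by
    rw [hV.integral_eq hS hT, ← hγ.closed, ← hu.closed, sub_self]
  have hw : IsPrimitive (t '' Iic (2 * n)) 0 (2 * T) (fun s => X (γ s) - c * X (u s))
      (fun s => (r s - c) * X (deriv u s)) := by
    have := ((hγ.isPrimitive hu X).add (hx.const_mul (-c))).congr
      (g' := fun s => (r s - c) * X (deriv u s)) fun s _ => by ring
    convert this using 2
    ring
  have i1 := hV.mul_intervalIntegrable hS hT hx.cont
  have i2 := hw.mul_intervalIntegrable hS hT hy.cont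
  have iF := ((i1.sub i2).add ((hV.intervalIntegrable hS hT).const_mul ξ)).const_mul k
  have hF0 : ∫ s in 0..(2 * T), k * ((X (u s) * ((r s - c) * Y (deriv u s)) -
      Y (u s) * ((r s - c) * X (deriv u s))) + ξ * ((r s - c) * Y (deriv u s))) = 0 := by
    rw [intervalIntegral.integral_const_mul, intervalIntegral.integral_add (i1.sub i2)
      ((hV.intervalIntegrable hS hT).const_mul ξ), hint, intervalIntegral.integral_const_mul, hVint]
    ring
  -- The factor `k`, the value of `r - c` on the arc, fixes the sign: there `F = 2 k² ξ y'`, and `ξ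
  -- y' > 0` by the orientation.
  set F : ℝ → ℝ := fun s => k * ((X (u s) * ((r s - c) * Y (deriv u s)) -
      Y (u s) * ((r s - c) * X (deriv u s))) + ξ * ((r s - c) * Y (deriv u s))) with hF
  have hXconst : ∀ {j : ℕ}, j < 2 * n → IsFlatArc u (initialVelocity t u) (t j) (t (j + 1)) →
      ∀ z ∈ Ioo (t j) (t (j + 1)), ∀ w ∈ Ioo (t j) (t (j + 1)), X (u z) = X (u w) := by
    intro j hj hf z hz w hw
    have hle := (hu.t_lt j hj).le
    have hp := hx.mono (hu.Icc_subset hj (left_mem_Icc.2 hle)).1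
      (hu.Icc_subset hj (right_mem_Icc.2 hle)).2
    have e : ∀ q ∈ Icc (t j) (t (j + 1)), X (u q) = X (u (t j)) := fun q hq =>
      hp.eq_of_deriv_eq_zero hS (fun z hz => hXflat hf z hz.1) hq
    rw [e z (Ioo_subset_Icc_self hz), e w (Ioo_subset_Icc_self hw)]
  have hFpos : ∀ z ∈ Ioo (t i) (t (i + 1)), 0 < F z := by
    intro z hz
    have h1 := hu.coord_det_pos hi (Ioo_subset_Icc_self hz)
    rw [IsPiecewiseSmooth.derivWithin_eq hz, ← hX, ← hY, hXflat hflat z hz, mul_zero, sub_zero,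
      hXconst hi hflat z hz s hs, ← hξ] at h1
    have h2 : F z = 2 * k ^ 2 * (ξ * Y (deriv u z)) := by
      simp only [hF]
      rw [hXflat hflat z hz, hXconst hi hflat z hz s hs, hk z hz, ← hξ]
      ring
    rw [h2]
    positivity
  have hFzero : ∀ j < 2 * n, j ≠ i → ∀ z ∈ Ioo (t j) (t (j + 1)), F z = 0 := by
    intro j hj hji z hz
    by_cases hrz : r z - c = 0
    · simp only [hF, hrz]
      ring
    obtain ⟨hfj, -⟩ := hγ.flat_of_ne hu h hj hz hrz
    have hzξ : X (u z) ≠ ξ := fun he => by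
      rcases lt_or_gt_of_ne hji with hlt | hlt
      · exact hu.flat_arc_unique hlt hi hfj hflat hz hs he
      · exact hu.flat_arc_unique hlt hj hflat hfj hs hz he.symm
    have hz1 : X (u z) = 1 ∨ X (u z) = -1 := hu.coordX_eq_of_deriv hj hz (hXflat hfj z hz)
    have hsum : X (u z) + ξ = 0 := by
      rcases hξ1 with h1 | h1 <;> rcases hz1 with h2 | h2 <;> rw [h1, h2] at hzξ ⊢ <;>
        first | (exact absurd rfl hzξ) | norm_num
    simp only [hF]
    rw [hXflat hfj z hz]
    linear_combination k * (r z - c) * Y (deriv u z) * hsum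
  have hti := hu.t_lt i hi
  have ht0 : 0 ≤ t i := (hu.Icc_subset hi (left_mem_Icc.2 hti.le)).1
  have ht1 : t (i + 1) ≤ 2 * T := (hu.Icc_subset hi (right_mem_Icc.2 hti.le)).2
  have j1 : IntervalIntegrable F volume 0 (t i) :=
    iF.mono_set (by rw [uIcc_of_le ht0, uIcc_of_le hT]; exact Icc_subset_Icc le_rfl (hti.le.trans ht1))
  have j2 : IntervalIntegrable F volume (t i) (t (i + 1)) :=
    iF.mono_set (by rw [uIcc_of_le hti.le, uIcc_of_le hT]; exact Icc_subset_Icc ht0 ht1)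
  have j3 : IntervalIntegrable F volume (t (i + 1)) (2 * T) :=
    iF.mono_set (by rw [uIcc_of_le ht1, uIcc_of_le hT]; exact Icc_subset_Icc (ht0.trans hti.le) le_rfl)
  have k1 : ∫ z in 0..t i, F z = 0 := by
    rw [integral_congr_off_countable hS ht0 (g := fun _ => 0) fun z hz => ?_]
    · simp
    · obtain ⟨j, hj, hzj⟩ := hu.exists_mem_Ioo ⟨⟨hz.1.1, hz.1.2.trans (hti.trans_le ht1)⟩, hz.2⟩
      exact hFzero j hj (by rintro rfl; exact lt_asymm hz.1.2 hzj.1) z hzj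
  have k3 : ∫ z in t (i + 1)..(2 * T), F z = 0 := by
    rw [integral_congr_off_countable hS ht1 (g := fun _ => 0) fun z hz => ?_]
    · simp
    · obtain ⟨j, hj, hzj⟩ := hu.exists_mem_Ioo ⟨⟨(ht0.trans_lt hti).trans hz.1.1, hz.1.2⟩, hz.2⟩
      exact hFzero j hj (by rintro rfl; exact lt_asymm hz.1.1 hzj.2) z hzj
  have k2 : 0 < ∫ z in t i..t (i + 1), F z :=
    intervalIntegral.intervalIntegral_pos_of_pos_on j2 hFpos hti
  have e1 := intervalIntegral.integral_add_adjacent_intervals j1 j2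
  have e2 := intervalIntegral.integral_add_adjacent_intervals (j1.trans j2) j3
  linarith

/-- The signed areas and the dual length of a curve `c u + p`. -/
theorem dualLength_sq_eq (hγ : IsAdmissible T n t u γ r) (hu : IsUnitCircle N T n t u) {c : ℝ}
    {p : ℝ × ℝ} (h : ∀ s ∈ Icc 0 (2 * T), γ s = c • u s + p) :
    dualLength T u r ^ 2 = 4 * area T γ * area T u := by
  have hS := IsPartition.countable (2 * n) t
  have hT : 0 ≤ 2 * T := by linarith [hu.T_pos]
  have hr : ∀ s ∈ Ioo 0 (2 * T) \ t '' Iic (2 * n), r s = c := by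
    intro s hs
    obtain ⟨i, hi, his⟩ := hu.exists_mem_Ioo hs
    have h1 : HasDerivAt γ (c • deriv u s) s := by
      refine (((hu.hasDerivAt hi his).const_smul c).add_const p).congr_of_eventuallyEq ?_
      filter_upwards [Ioo_mem_nhds hs.1.1 hs.1.2] with z hz using h z (Ioo_subset_Icc_self hz)
    have h2 := h1.deriv
    rw [hγ.deriv_eq i hi s his, ← sub_eq_zero, ← sub_smul] at h2
    exact sub_eq_zero.1 ((smul_eq_zero.1 h2).resolve_right (hu.deriv_ne hi his))
  obtain ⟨m, hm⟩ := hu.exists_isConvexLoop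
  have iD : IntervalIntegrable (fun s => det (u s) (deriv u s)) volume 0 (2 * T) := by
    rw [funext fun s => det_eq_coord hu.det_initial_ne_zero (u s) (deriv u s)]
    exact ((hm.hy.mul_intervalIntegrable hS hT hm.hx.cont).sub
      (hm.hx.mul_intervalIntegrable hS hT hm.hy.cont)).const_mul _
  have hL : dualLength T u r = c * ∫ s in 0..(2 * T), det (u s) (deriv u s) := by
    rw [dualLength, ← intervalIntegral.integral_const_mul]
    exact integral_congr_off_countable hS hT fun s hs => by rw [hr s hs]
  have hp := hu.isPrimitive hu.piecewiseSmooth (detLeft p)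
  have hA : area T γ = 1 / 2 * (c ^ 2 * ∫ s in 0..(2 * T), det (u s) (deriv u s)) := by
    -- The translation contributes `c [p, u']`, whose integral over the closed curve is zero.
    have e1 : c ^ 2 * ∫ s in 0..(2 * T), det (u s) (deriv u s) =
        ∫ s in 0..(2 * T), (c ^ 2 * det (u s) (deriv u s) + c * detLeft p (deriv u s)) := by
      rw [intervalIntegral.integral_add (iD.const_mul _)
        ((hp.intervalIntegrable hS hT).const_mul c), intervalIntegral.integral_const_mul,
        intervalIntegral.integral_const_mul, hp.integral_eq hS hT, hu.closed]
      ring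
    rw [area, mixedArea, e1]
    congr 1
    refine integral_congr_off_countable hS hT fun s hs => ?_
    rw [hγ.deriv_eq_off hu hs, hr s hs, h s (Ioo_subset_Icc_self hs.1), detLeft_apply]
    simp only [det, Prod.fst_add, Prod.snd_add, Prod.smul_fst, Prod.smul_snd, smul_eq_mul]
    ring
  rw [hL, hA, area, mixedArea]
  ring

/-- Minkowski's inequality for an admissible curve. -/
theorem minkowski (hγ : IsAdmissible T n t u γ r) (hu : IsUnitCircle N T n t u) :
    4 * area T γ * area T u ≤ dualLength T u r ^ 2 ∧
    (dualLength T u r ^ 2 = 4 * area T γ * area T u →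
      ∃ (c : ℝ) (p : ℝ × ℝ), ∀ s ∈ Icc 0 (2 * T), γ s = c • u s + p) := by
  have hS := IsPartition.countable (2 * n) t
  have hT : 0 ≤ 2 * T := by linarith [hu.T_pos]
  have hne := hu.det_initial_ne_zero
  obtain ⟨m, hm⟩ := hu.exists_isConvexLoop
  obtain ⟨C, hC⟩ := hγ.exists_bound hu
  -- With `u` admissible of radius `1`, `area_eq` covers both areas. In coordinates both sides then
  -- carry the factor `det (u 0) (initialVelocity t u) ^ 2`.
  have hu1 : IsAdmissible T n t u u fun _ => 1 :=
    ⟨hu.closed, hu.smooth, fun _ _ _ _ => (one_smul ℝ _).symm, fun _ _ _ => ⟨1, fun _ _ => rfl⟩⟩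
  obtain ⟨h1, h2⟩ := hm.minkowski (hγ.isPrimitive hu _) (hγ.isPrimitive hu _) hC
    (by rw [hu.closed]) (by rw [hu.closed]) (by rw [hγ.closed]) (by rw [hγ.closed])
  rw [hγ.area_eq hu, dualLength_eq hu, hu1.area_eq hu]
  simp only [one_mul]
  have hsq := pow_pos (abs_pos.2 hne) 2
  rw [sq_abs] at hsq
  refine ⟨?_, fun heq => ?_⟩
  · have := mul_le_mul_of_nonneg_left h1 hsq.le
    linarith
  obtain ⟨c, p, h4, h5⟩ := h2 (mul_left_cancel₀ hsq.ne' (by linear_combination heq))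
  have hW := hγ.coordX_sub_eq_zero hu (c := c) (p := p) fun s hs hs0 => by
    obtain ⟨a1, -, δ, hδ, a2⟩ := h5 s hs hs0
    refine ⟨a1, δ, hδ, fun p hp q hq => ?_⟩
    rw [det_eq_coord hne, a2 p hp q hq, sub_self, mul_zero]
  have hr := hγ.radius_eq hu hW h4
  -- Once `r = c`, the second coordinate of `γ - c u` is constant too, and the translation vector is
  -- read off in the basis.
  have hY := (hγ.isPrimitive hu (coordY (u 0) (initialVelocity t u))).add
    ((hu.isPrimitive hu.piecewiseSmooth (coordY (u 0) (initialVelocity t u))).const_mul (-c))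
  have hYc : ∀ s ∈ Icc 0 (2 * T), _ := fun s hs => hY.eq_of_deriv_eq_zero hS (fun z hz => by
    obtain ⟨i, hi, hzi⟩ := hu.exists_mem_Ioo hz
    rw [hr i hi z hzi]
    ring) hs
  refine ⟨c, p • u 0 + (coordY (u 0) (initialVelocity t u) (γ 0) +
    -c * coordY (u 0) (initialVelocity t u) (u 0)) • initialVelocity t u, fun s hs => ?_⟩
  have hp : p = coordX (u 0) (initialVelocity t u) (γ s) -
      c * coordX (u 0) (initialVelocity t u) (u s) := by linarith [hW s hs]
  rw [← hYc s hs, hp]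
  have key : ∀ (g v a d : ℝ × ℝ) (x y x' y' : ℝ), g = x • a + y • d → v = x' • a + y' • d →
      g = c • v + ((x - c * x') • a + (y + -c * y') • d) := by
    rintro _ _ a d x y x' y' rfl rfl
    module
  exact key _ _ _ _ _ _ _ _ (coord_decomp hne (γ s)) (coord_decomp hne (u s))

end IsAdmissible

end NormedPlane

theorem mainTheorem5
    (N : Seminorm ℝ (ℝ × ℝ)) (hN : ∀ x, N x = 0 → x = 0)
    (T : ℝ) (n : ℕ) (t : ℕ → ℝ) (u : ℝ → ℝ × ℝ)
    (hu : NormedPlane.IsUnitCircle N T n t u)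
    (γ : ℝ → ℝ × ℝ) (r : ℝ → ℝ)
    (hγ : NormedPlane.IsAdmissible T n t u γ r) :
    4 * NormedPlane.area T γ * NormedPlane.area T u ≤ NormedPlane.dualLength T u r ^ 2 ∧
    (NormedPlane.dualLength T u r ^ 2 = 4 * NormedPlane.area T γ * NormedPlane.area T u ↔
      ∃ (c : ℝ) (p : ℝ × ℝ), ∀ s ∈ Set.Icc 0 (2 * T), γ s = c • u s + p) :=
  ⟨(hγ.minkowski hu).1, (hγ.minkowski hu).2, fun ⟨_, _, h⟩ => hγ.dualLength_sq_eq hu h⟩
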